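/- **Setting.** Let $\mathsf K$ be a simplicial complex of dimension at most $N$ in which every simplex is contained in at most $L$ simplices of one dimension more. All simplices are oriented; $\mathsf K_n$ is the set of $n$-simplices, $\mathsf C_n$ the free abelian group on $\mathsf K_n$, and $\epsilon_{x,y}\in\{0,\pm1\}$ the incidence numbers, so that $\partial x=\sum_y\epsilon_{x,y}\,y$ and $\hat\partial x=\sum_z\epsilon_{z,x}\,z$. Let $(G_\bullet,\partial^G)$, $\partial^G_j:G_j\to G_{j-1}$, be a chain complex of finite abelian groups with $G_j=0$ unless $0\le j\le N$. Let $\hat G_j$ be the character group of $G_j$, written additively, and let $\hat\partial^G:\hat G_{j-1}\to\hat G_{j}$, $\alpha\mapsto\alpha\circ\partial^G_j$. For $p\in\mathbb Z$, $\mathrm{Hom}_0(\mathsf C,G)^p$ (respectively $\mathrm{Hom}_0(\mathsf C,G)_p$) is the group of families of homomorphisms $t_n:\mathsf C_n\to G_{n-p}$ (respectively $\gamma_n:\mathsf C_n\to\hat G_{n-p}$), $n\ge0$, that vanish on all but finitely many simplices. Put $$\delta^pt=t\circ\partial-(-1)^p\,\partial^G\circ t,\qquad \delta_p\gamma=\gamma\circ\hat\partial-(-1)^{p-1}\,\hat\partial^G\circ\gamma,$$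 which raise, respectively lower, the degree $p$ by one, and $\gamma(t)=\prod_{x}\gamma(x)[t(x)]$; then $\gamma(\delta^pt)=(\delta_{p+1}\gamma)(t)$. For $x\in\mathsf K_n$ let $x^*_g$ (respectively $x_*^\alpha$) be the $p$-map (respectively dual $p$-map) with value $g\in G_{n-p}$ (respectively $\alpha\in\hat G_{n-p}$) at $x$ and $0$ at all other simplices. For finite $\Lambda\subset\mathsf K$ let $\mathfrak A_\Lambda=\mathcal B(\bigotimes_{x\in\Lambda}L^2(G_{\dim x}))$, let $\mathfrak A_{\rm loc}=\bigcup_\Lambda\mathfrak A_\Lambda$ under the inclusions $T\mapsto T\otimes1$, and let the quasi-local C*-algebra $\mathfrak A$ be its norm completion. For $t\in\mathrm{Hom}_0(\mathsf C,G)^0$ and $\gamma\in\mathrm{Hom}_0(\mathsf C,G)_0$ let $P_t,Q_\gamma\in\mathfrak A_{\rm loc}$ be the unitaries $P_t|f\rangle=|t+f\rangle$ and $Q_\gamma|f\rangle=\gamma(f)|f\rangle$. Put $A_t=P_{\delta^{-1}t}$ for $t\in\mathrm{Hom}_0(\mathsf C,G)^{-1}$, $B_\gamma=Q_{\delta_1\gamma}$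 for $\gamma\in\mathrm{Hom}_0(\mathsf C,G)_1$, and for $x\in\mathsf K_n$ $$A^0_x=\frac1{|G_{n+1}|}\sum_{g\in G_{n+1}}A_{x^*_g},\qquad B^0_x=\frac1{|G_{n-1}|}\sum_{\alpha\in\hat G_{n-1}}B_{x_*^\alpha},$$ with supports $\mathrm{supp}(A^0_x)=\{x\}\cup\{z:\epsilon_{z,x}\ne0\}$ and $\mathrm{supp}(B^0_x)=\{x\}\cup\{y:\epsilon_{x,y}\ne0\}$. Let $$H^\Lambda=-\Big(\sum_{\mathrm{supp}(A^0_x)\subseteq\Lambda}A^0_x+\sum_{\mathrm{supp}(B^0_x)\subseteq\Lambda}B^0_x\Big),\qquad \delta_{\rm QDM}(T)=i[H^\Lambda,T]\quad(T\in\mathfrak A_{\rm loc},\ \Lambda\text{ finite and large enough}).$$ For a unital C*-algebra $R$ let $\mathtt S(R)$ be its state space with the weak-$*$ topology and $\mathtt P(R)$ the set of its pure states, that is, the extreme points of $\mathtt S(R)$. Let $\mathtt{FG}_{\rm QDM}(\mathfrak A)$ be the set of frustration-free ground states: the $\omega\in\mathtt S(\mathfrak A)$ with $-i\,\omega(T^*\delta_{\rm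 QDM}(T))\ge0$ for all $T\in\mathfrak A_{\rm loc}$ and $\omega(A_x^0)=\omega(B_y^0)=1$ for all $x,y\in\mathsf K$. Let $\mathtt{FG}^\circ_{\rm QDM}(\mathfrak A)=\mathtt{FG}_{\rm QDM}(\mathfrak A)\cap\mathtt P(\mathfrak A)$. Let $\mathfrak K\subset\mathfrak A$ be the C*-subalgebra generated by all $A_t$ and $B_\gamma$, let $\mathfrak K'$ be its commutant in $\mathfrak A$, let $\mathfrak J\subset\mathfrak K'$ be the closed linear span of all $P_tQ_\gamma-P_{t'}Q_{\gamma'}$ with $t,t'\in\mathrm{Ker}\,\delta^0$, $\gamma,\gamma'\in\mathrm{Ker}\,\delta_0$, $t-t'\in\mathrm{Im}\,\delta^{-1}$ and $\gamma-\gamma'\in\mathrm{Im}\,\delta_1$ (a closed two-sided self-adjoint ideal of $\mathfrak K'$), and let $\mathfrak A_{\rm log}=\mathfrak K'/\mathfrak J$ with quotient map $\pi:\mathfrak K'\to\mathfrak A_{\rm log}$. **Proposition.** There is a homeomorphism $\Phi:\mathtt S(\mathfrak A_{\rm log})\to\mathtt{FG}_{\rm QDM}(\mathfrak A)$ such that,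 for every $\rho\in\mathtt S(\mathfrak A_{\rm log})$, $\Phi(\rho)$ is the unique frustration-free ground state whose restriction to $\mathfrak K'$ is $\rho\circ\pi$. A state $\rho$ is pure if and only if $\Phi(\rho)\in\mathtt{FG}^\circ_{\rm QDM}(\mathfrak A)$, and $\Phi$ restricts to a homeomorphism $\mathtt P(\mathfrak A_{\rm log})\to\mathtt{FG}^\circ_{\rm QDM}(\mathfrak A)$. Moreover, if $\omega\in\mathtt{FG}_{\rm QDM}(\mathfrak A)$ and $\omega=\lambda\omega_1+(1-\lambda)\omega_2$ with $\omega_1,\omega_2\in\mathtt S(\mathfrak A)$ and $0<\lambda<1$, then $\omega_1,\omega_2\in\mathtt{FG}_{\rm QDM}(\mathfrak A)$. -/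

import Mathlib

open scoped ENNReal lp ComplexOrder Topology
open Filter

namespace HAQDM

universe u w

noncomputable section

/-! ### Geometric and algebraic data -/

/-- An `N`-dimensional, `L`-regular simplicial complex on the vertex set `V`, with a chosen
orientation of every simplex.  The linear order on `V` only serves as a reference: the order it
induces on the vertices of a simplex `x` is one orientation of `x`, and `orient x = ±1` says whether
the chosen orientation is that one or the opposite one. -/
structure GeometricData (V : Type u) [LinearOrder V] (N L : ℕ) where
  cplx : AbstractSimplicialComplex V
  card_le : ∀ x ∈ cplx.faces, x.card ≤ N + 1
  order_le : ∀ x ∈ cplx.faces,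
    {z | z ∈ cplx.faces ∧ x ⊆ z ∧ z.card = x.card + 1}.encard ≤ L
  orient : cplx.faces → ℤˣ

/-- A chain complex of finite abelian groups `grp j`, `j ∈ ℤ`, vanishing for `j < 0` and `j > N`.
The boundary map `G_j → G_{j-1}` is `bdry j (j - 1)`; `bdry i j` is zero unless `j + 1 = i`. -/
structure AlgebraicData (N : ℕ) where
  grp : ℤ → Type w
  [addCommGroup : ∀ j, AddCommGroup (grp j)]
  [fintype : ∀ j, Fintype (grp j)]
  bdry : ∀ i j, grp i →+ grp j
  bdry_eq_zero : ∀ i j, j + 1 ≠ i → bdry i j = 0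
  bdry_bdry : ∀ i j k g, bdry j k (bdry i j g) = 0
  subsingleton_of_neg : ∀ j, j < 0 → Subsingleton (grp j)
  subsingleton_of_gt : ∀ j, (N : ℤ) < j → Subsingleton (grp j)

attribute [instance] AlgebraicData.addCommGroup AlgebraicData.fintype

variable {V : Type u} [LinearOrder V] {N L : ℕ}

/-- The set of all simplices of the complex. -/
abbrev GeometricData.Simplex (K : GeometricData V N L) : Type u := K.cplx.faces

variable (K : GeometricData V N L) (G : AlgebraicData.{w} N)

variable {K} in
/-- The dimension of a simplex (number of vertices minus one). -/
def dim (x : K.Simplex) : ℤ := (x.1.card : ℤ) - 1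

variable {K} in
/-- The incidence number `ε_{x,y}`: it is `0` unless `y` is a face of codimension one of `x`, and
for `x = [v₀, …, vₙ]`, `y = ±[v₀, …, v̂ᵢ, …, vₙ]` it is `±(-1)^i`.  Here `i` is computed in the
reference order as the number of vertices of `x` that precede the omitted vertex. -/
def incidence (x y : K.Simplex) : ℤ :=
  if y.1 ⊆ x.1 ∧ x.1.card = y.1.card + 1 then
    (K.orient x : ℤ) * (K.orient y : ℤ) * (-1) ^ (x.1.filter fun a => ∃ v ∈ x.1 \ y.1, a < v).card
  else 0

/-- Finitely supported maps of degree `p` on the simplices with values in a graded abelian group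
`M`: to a simplex `x` of dimension `n` is attached an element of `M_{n-p}`, viewed as the sequence
`t x ∈ ∏ⱼ M_j` all of whose other components vanish.  Since the chain group `C_n` is free on the
`n`-simplices, this is the same as a finitely supported family of homomorphisms `C_n → M_{n-p}`. -/
def FinMaps (M : ℤ → Type w) [∀ j, AddCommGroup (M j)] (p : ℤ) :
    AddSubgroup (K.Simplex →₀ ∀ j, M j) where
  carrier := {t | ∀ x j, j ≠ dim x - p → t x j = 0}
  zero_mem' := fun _ _ _ => rfl
  add_mem' := fun {a b} ha hb x j h => by simp [ha x j h, hb x j h]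
  neg_mem' := fun {a} ha x j h => by simp [ha x j h]

/-- The dual group `Ĝ_j`: the characters of `G_j`, which form a group under pointwise
multiplication, written additively. -/
def AlgebraicData.dual (j : ℤ) : Type w := AddChar (G.grp j) ℂ

instance (j : ℤ) : AddCommGroup (G.dual j) := inferInstanceAs (AddCommGroup (AddChar (G.grp j) ℂ))

instance (j : ℤ) : FunLike (G.dual j) (G.grp j) ℂ :=
  inferInstanceAs (FunLike (AddChar (G.grp j) ℂ) (G.grp j) ℂ)

instance (j : ℤ) : Fintype (G.dual j) := inferInstanceAs (Fintype (AddChar (G.grp j) ℂ))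

/-- The transpose `Ĝ_j → Ĝ_i` of `∂ : G_i → G_j`, namely `α ↦ α ∘ ∂`. -/
def AlgebraicData.dualBdry (i j : ℤ) : G.dual j →+ G.dual i where
  toFun α := AddChar.compAddMonoidHom (show AddChar (G.grp j) ℂ from α) (G.bdry i j)
  map_zero' := rfl
  map_add' _ _ := rfl

/-- `Hom₀(C,G)^p`, the compactly supported `p`-maps. -/
abbrev Hom₀ (p : ℤ) : AddSubgroup (K.Simplex →₀ ∀ j, G.grp j) := FinMaps K G.grp p

/-- `Hom₀(C,G)_p`, the compactly supported dual `p`-maps. -/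
abbrev HomDual₀ (p : ℤ) : AddSubgroup (K.Simplex →₀ ∀ j, G.dual j) := FinMaps K G.dual p

section Incidence

variable {K}

theorem dim_of_incidence {x y : K.Simplex} (h : incidence x y ≠ 0) : dim y = dim x - 1 := by
  unfold incidence at h
  split_ifs at h with h'
  · simp only [dim, h'.2]; push_cast; ring
  · exact absurd rfl h

theorem finite_faces (x : K.Simplex) : {y : K.Simplex | incidence x y ≠ 0}.Finite := by
  refine Set.Finite.of_finite_image (f := Subtype.val)
    ((x.1.powerset.finite_toSet).subset ?_) Subtype.val_injective.injOn
  rintro _ ⟨y, hy, rfl⟩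
  simp only [Finset.coe_powerset, Set.mem_preimage, Set.mem_powerset_iff, Finset.coe_subset]
  by_contra hc
  exact hy (by unfold incidence; rw [if_neg (fun h => hc h.1)])

theorem finite_cofaces (y : K.Simplex) : {x : K.Simplex | incidence x y ≠ 0}.Finite := by
  have hfin : {z | z ∈ K.cplx.faces ∧ y.1 ⊆ z ∧ z.card = y.1.card + 1}.Finite :=
    Set.finite_of_encard_le_coe (K.order_le y.1 y.2)
  refine Set.Finite.of_finite_image (f := Subtype.val)
    (hfin.subset ?_) Subtype.val_injective.injOn
  rintro _ ⟨x, hx, rfl⟩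
  by_contra hc
  exact hx (by unfold incidence; rw [if_neg (fun h => hc ⟨x.2, h.1, h.2⟩)])

end Incidence

section Characters

variable {G} {j : ℤ}

theorem dual_ext {α β : G.dual j} (h : ∀ g, α g = β g) : α = β := DFunLike.ext _ _ h

theorem dual_zero_apply (g : G.grp j) : (0 : G.dual j) g = 1 := rfl

theorem dual_add_apply (α β : G.dual j) (g : G.grp j) : (α + β) g = α g * β g := rfl

theorem dual_map_zero (α : G.dual j) : α 0 = 1 := AddChar.map_zero_eq_one α

theorem dual_map_add (α : G.dual j) (g h : G.grp j) : α (g + h) = α g * α h :=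
  AddChar.map_add_eq_mul α g h

theorem dual_map_neg (α : G.dual j) (g : G.grp j) : α (-g) = (α g)⁻¹ :=
  AddChar.map_neg_eq_inv α g

theorem dual_neg_apply (α : G.dual j) (g : G.grp j) : (-α) g = (α g)⁻¹ :=
  AddChar.neg_apply' α g

theorem dual_map_zsmul (α : G.dual j) (c : ℤ) (g : G.grp j) : α (c • g) = α g ^ c :=
  AddChar.map_zsmul_eq_zpow α c g

theorem dual_zsmul_apply (c : ℤ) (α : G.dual j) (g : G.grp j) : (c • α) g = α g ^ c := by
  cases c with
  | ofNat n => rw [Int.ofNat_eq_natCast, natCast_zsmul, zpow_natCast]; rfl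
  | negSucc n => rw [negSucc_zsmul, dual_neg_apply, zpow_negSucc]; rfl

theorem norm_dual_apply (α : G.dual j) (g : G.grp j) : ‖α g‖ = 1 := AddChar.norm_apply α g

theorem dualBdry_apply (i : ℤ) (α : G.dual j) (g : G.grp i) :
    G.dualBdry i j α g = α (G.bdry i j g) := rfl

theorem dual_pow_card (α : G.dual j) (g : G.grp j) : α g ^ Fintype.card (G.grp j) = 1 := by
  rw [← zpow_natCast, ← dual_map_zsmul, natCast_zsmul, card_nsmul_eq_zero, dual_map_zero]

theorem exists_dual_ne (α : G.dual j) (h : α ≠ 0) : ∃ g, α g ≠ 1 := by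
  by_contra! hc
  exact h (dual_ext hc)

theorem exists_dual_apply_ne (g : G.grp j) (h : g ≠ 0) : ∃ α : G.dual j, α g ≠ 1 :=
  AddChar.exists_apply_ne_zero.2 h

end Characters

/-! ### The coboundary on maps and the boundary on dual maps -/

/-- The coboundary `(δ^p t)(x) = t(∂x) - (-1)^p ∂(t(x))`, where `∂x = ∑ y, ε_{x,y} y`. -/
def coboundaryTotal (p : ℤ) : (K.Simplex →₀ ∀ j, G.grp j) →+ (K.Simplex →₀ ∀ j, G.grp j) where
  toFun t := Finsupp.ofSupportFinite
    (fun x j => (t.sum fun y g => incidence x y • g j)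
      - p.negOnePow • G.bdry (j + 1) j (t x (j + 1))) (by
    refine ((t.support.finite_toSet.biUnion fun y _ => finite_cofaces y).union
      t.support.finite_toSet).subset fun x hx => ?_
    by_contra hc
    simp only [Set.mem_union, Set.mem_iUnion, not_or, not_exists] at hc
    refine hx (funext fun j => ?_)
    have h1 : t x = 0 := by simpa using hc.2
    have h2 : (t.sum fun y g => incidence x y • g j) = 0 := Finset.sum_eq_zero fun y hy => by
      have := hc.1 y hy
      simp only [Set.mem_ofPred_eq, not_not] at this
      simp [this]
    simp [h1, h2])
  map_zero' := by ext x j; simp [Finsupp.ofSupportFinite]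
  map_add' s t := by
    ext x j
    have : ((s + t).sum fun y g => incidence x y • g j)
        = (s.sum fun y g => incidence x y • g j) + (t.sum fun y g => incidence x y • g j) :=
      Finsupp.sum_add_index' (by simp) (by simp)
    change ((s + t).sum fun y g => incidence x y • g j) - _ = (_ - _) + (_ - _)
    simp only [this, Finsupp.coe_add, Pi.add_apply, map_add, smul_add]
    abel

/-- The boundary `(δ_p γ)(x) = γ(∂̂x) - (-1)^(p-1) ∂̂(γ(x))`, where `∂̂x = ∑ z, ε_{z,x} z` and
`∂̂ : Ĝ_{j-1} → Ĝ_j` is the transpose of `∂ : G_j → G_{j-1}`. -/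
def boundaryTotal (p : ℤ) : (K.Simplex →₀ ∀ j, G.dual j) →+ (K.Simplex →₀ ∀ j, G.dual j) where
  toFun γ := Finsupp.ofSupportFinite
    (fun x j => (γ.sum fun z α => incidence z x • α j)
      - (p - 1).negOnePow • G.dualBdry j (j - 1) (γ x (j - 1))) (by
    refine ((γ.support.finite_toSet.biUnion fun y _ => finite_faces y).union
      γ.support.finite_toSet).subset fun x hx => ?_
    by_contra hc
    simp only [Set.mem_union, Set.mem_iUnion, not_or, not_exists] at hc
    refine hx (funext fun j => ?_)
    have h1 : γ x = 0 := by simpa using hc.2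
    have h2 : (γ.sum fun z α => incidence z x • α j) = 0 := Finset.sum_eq_zero fun y hy => by
      have := hc.1 y hy
      simp only [Set.mem_ofPred_eq, not_not] at this
      simp [this]
    simp [h1, h2])
  map_zero' := by
    ext x j : 2
    simp [Finsupp.ofSupportFinite]
  map_add' s t := by
    ext x j : 2
    have : ((s + t).sum fun z α => incidence z x • α j)
        = (s.sum fun z α => incidence z x • α j) + (t.sum fun z α => incidence z x • α j) :=
      Finsupp.sum_add_index' (by simp) (by simp)
    change ((s + t).sum fun z α => incidence z x • α j) - _ = (_ - _) + (_ - _)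
    simp only [this, Finsupp.coe_add, Pi.add_apply, map_add, smul_add]
    abel

theorem coboundaryTotal_apply (p : ℤ) (t : K.Simplex →₀ ∀ j, G.grp j) (x : K.Simplex) (j : ℤ) :
    coboundaryTotal K G p t x j = (t.sum fun y g => incidence x y • g j)
      - p.negOnePow • G.bdry (j + 1) j (t x (j + 1)) := rfl

theorem boundaryTotal_apply (p : ℤ) (γ : K.Simplex →₀ ∀ j, G.dual j) (x : K.Simplex) (j : ℤ) :
    boundaryTotal K G p γ x j = (γ.sum fun z α => incidence z x • α j)
      - (p - 1).negOnePow • G.dualBdry j (j - 1) (γ x (j - 1)) := rfl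

/-- The coboundary `δ^p : Hom₀(C,G)^p → Hom₀(C,G)^q`, `q = p + 1`. -/
def coboundary (p q : ℤ) (h : p + 1 = q) : Hom₀ K G p →+ Hom₀ K G q :=
  ((coboundaryTotal K G p).comp (Hom₀ K G p).subtype).codRestrict (Hom₀ K G q) fun t x j hj => by
    subst h
    simp only [AddMonoidHom.comp_apply, AddSubgroup.subtype_apply, coboundaryTotal_apply]
    have h1 : t.1 x (j + 1) = 0 := t.2 x _ (by omega)
    have h2 : (t.1.sum fun y g => incidence x y • g j) = 0 := Finset.sum_eq_zero fun y _ => by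
      by_cases hi : incidence x y = 0
      · simp [hi]
      · have := dim_of_incidence hi
        simp [t.2 y j (by omega)]
    simp [h1, h2]

/-- The boundary `δ_p : Hom₀(C,G)_p → Hom₀(C,G)_q`, `q = p - 1`. -/
def boundary (p q : ℤ) (h : p - 1 = q) : HomDual₀ K G p →+ HomDual₀ K G q :=
  ((boundaryTotal K G p).comp (HomDual₀ K G p).subtype).codRestrict (HomDual₀ K G q)
    fun γ x j hj => by
    subst h
    simp only [AddMonoidHom.comp_apply, AddSubgroup.subtype_apply, boundaryTotal_apply]
    have h1 : γ.1 x (j - 1) = 0 := γ.2 x _ (by omega)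
    have h2 : (γ.1.sum fun z α => incidence z x • α j) = 0 := Finset.sum_eq_zero fun z _ => by
      by_cases hi : incidence z x = 0
      · simp [hi]
      · have := dim_of_incidence hi
        simp [γ.2 z j (by omega)]
    simp [h1, h2]

variable {K G} in
/-- The pairing `γ(t) = ∏ₓ γ(x)[t(x)]` of a dual `p`-map with a `p`-map; for a simplex `x` of
dimension `n`, the character `γ(x) ∈ Ĝ_{n-p}` is evaluated at `t(x) ∈ G_{n-p}`. -/
def pairing (p : ℤ) (γ : K.Simplex →₀ ∀ j, G.dual j) (t : K.Simplex →₀ ∀ j, G.grp j) : ℂ :=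
  t.prod fun x g => γ x (dim x - p) (g (dim x - p))

/-- The map `x^*_g` of degree `p` with value `g ∈ G_{n-p}` at the `n`-simplex `x`, zero elsewhere. -/
def localMap (p : ℤ) (x : K.Simplex) (g : G.grp (dim x - p)) : Hom₀ K G p :=
  ⟨Finsupp.single x (Pi.single (dim x - p) g), fun y j hj => by
    rcases eq_or_ne x y with rfl | h
    · rw [Finsupp.single_eq_same, Pi.single_eq_of_ne hj]
    · rw [Finsupp.single_eq_of_ne h.symm]; rfl⟩

/-- The dual map `x_*^α` of degree `p` with value `α ∈ Ĝ_{n-p}` at the `n`-simplex `x`, zero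
elsewhere. -/
def localDualMap (p : ℤ) (x : K.Simplex) (α : G.dual (dim x - p)) : HomDual₀ K G p :=
  ⟨Finsupp.single x (Pi.single (dim x - p) α), fun y j hj => by
    rcases eq_or_ne x y with rfl | h
    · rw [Finsupp.single_eq_same, Pi.single_eq_of_ne hj]
    · rw [Finsupp.single_eq_of_ne h.symm]; rfl⟩

section Pairing

variable {K G}

theorem pairing_zero_left (p : ℤ) (t : K.Simplex →₀ ∀ j, G.grp j) :
    pairing p (0 : K.Simplex →₀ ∀ j, G.dual j) t = 1 := by
  simp [pairing, Finsupp.prod, dual_zero_apply]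

theorem pairing_zero_right (p : ℤ) (γ : K.Simplex →₀ ∀ j, G.dual j) :
    pairing p γ (0 : K.Simplex →₀ ∀ j, G.grp j) = 1 := by
  simp [pairing]

theorem pairing_add_left (p : ℤ) (γ γ' : K.Simplex →₀ ∀ j, G.dual j)
    (t : K.Simplex →₀ ∀ j, G.grp j) :
    pairing p (γ + γ') t = pairing p γ t * pairing p γ' t := by
  simp [pairing, dual_add_apply]

theorem pairing_add_right (p : ℤ) (γ : K.Simplex →₀ ∀ j, G.dual j)
    (t t' : K.Simplex →₀ ∀ j, G.grp j) :
    pairing p γ (t + t') = pairing p γ t * pairing p γ t' :=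
  Finsupp.prod_add_index' (by simp [dual_map_zero]) (by simp [dual_map_add])

theorem pairing_single_right (p : ℤ) (γ : K.Simplex →₀ ∀ j, G.dual j) (x : K.Simplex)
    (g : ∀ j, G.grp j) :
    pairing p γ (Finsupp.single x g) = γ x (dim x - p) (g (dim x - p)) :=
  Finsupp.prod_single_index (by simp [dual_map_zero])

theorem pairing_single_left (p : ℤ) (x : K.Simplex) (α : ∀ j, G.dual j)
    (t : K.Simplex →₀ ∀ j, G.grp j) :
    pairing p (Finsupp.single x α) t = α (dim x - p) (t x (dim x - p)) := by
  classical
  unfold pairing Finsupp.prod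
  rw [Finset.prod_eq_single x]
  · simp
  · intro y _ hy
    simp [Finsupp.single_eq_of_ne hy, dual_zero_apply]
  · intro hx
    simp only [Finsupp.mem_support_iff, not_not] at hx
    simp [hx, dual_map_zero]

theorem norm_pairing (p : ℤ) (γ : K.Simplex →₀ ∀ j, G.dual j) (t : K.Simplex →₀ ∀ j, G.grp j) :
    ‖pairing p γ t‖ = 1 := by
  simp [pairing, Finsupp.prod, norm_dual_apply]

/-- The duality `γ(δ^p t) = (δ_{p+1} γ)(t)`. -/
theorem pairing_coboundaryTotal (p : ℤ) (γ : K.Simplex →₀ ∀ j, G.dual j)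
    (t : K.Simplex →₀ ∀ j, G.grp j) :
    pairing (p + 1) γ (coboundaryTotal K G p t) = pairing p (boundaryTotal K G (p + 1) γ) t := by
  classical
  induction t using Finsupp.induction_linear with
  | zero => simp [pairing_zero_right]
  | add s t hs ht => simp [pairing_add_right, hs, ht]
  | single y g =>
  induction γ using Finsupp.induction_linear with
  | zero => simp [pairing_zero_left]
  | add s t hs ht => simp [pairing_add_left, hs, ht]
  | single x α =>
  rw [pairing_single_left, pairing_single_right, coboundaryTotal_apply, boundaryTotal_apply,
    Finsupp.sum_single_index (by simp), Finsupp.sum_single_index (by simp), add_sub_cancel_right,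
    sub_eq_add_neg (incidence x y • _), sub_eq_add_neg (incidence x y • _), dual_add_apply,
    dual_map_add, dual_map_neg, dual_neg_apply, dual_zsmul_apply, dual_map_zsmul,
    Units.smul_def, Units.smul_def, dual_zsmul_apply, dual_map_zsmul]
  congr 1
  · by_cases hi : incidence x y = 0
    · simp [hi]
    · have h : dim x - (p + 1) = dim y - p := by rw [dim_of_incidence hi]; ring
      rw [h]
  · congr 2
    rcases eq_or_ne x y with rfl | h
    · have key : ∀ j j' : ℤ, j' = j + 1 → α j (G.bdry (j + 1) j (g (j + 1)))
            = G.dualBdry j' (j' - 1) (α (j' - 1)) (g j') := by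
        rintro j _ rfl
        have : j + 1 - 1 = j := by ring
        rw [this, dualBdry_apply]
      simpa using key (dim x - (p + 1)) (dim x - p) (by ring)
    · simp [Finsupp.single_eq_of_ne h, Finsupp.single_eq_of_ne h.symm, dual_zero_apply,
        dual_map_zero]

end Pairing

/-! ### Operators on the Hilbert space of finitely supported configurations -/

section WeightedShift

variable {ι : Type*}

theorem memlp_weighted (c : ι → ℂ) (hc : ∀ i, ‖c i‖ = 1) (e : ι ≃ ι) (ψ : ℓ^2(ι, ℂ)) :
    Memℓp (fun i => c i * ψ (e i)) 2 := by
  refine memℓp_gen ?_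
  have := (lp.memℓp ψ).summable (by simp)
  simpa [hc, Function.comp_def] using
    (e.summable_iff (f := fun i => ‖ψ i‖ ^ (2 : ℝ≥0∞).toReal)).2 this

/-- The isometry `(Uψ)(i) = c(i) ψ(e(i))` of `ℓ²(ι)`, where `|c(i)| = 1` and `e` is a permutation. -/
def weightedShift (c : ι → ℂ) (hc : ∀ i, ‖c i‖ = 1) (e : ι ≃ ι) : ℓ^2(ι, ℂ) →ₗᵢ[ℂ] ℓ^2(ι, ℂ) where
  toFun ψ := ⟨fun i => c i * ψ (e i), memlp_weighted c hc e ψ⟩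
  map_add' φ ψ := by
    apply lp.ext; funext i
    exact mul_add _ _ _
  map_smul' a ψ := by
    apply lp.ext; funext i
    exact mul_left_comm _ _ _
  norm_map' ψ := by
    have h2 : (0 : ℝ) < (2 : ℝ≥0∞).toReal := by simp
    rw [lp.norm_eq_tsum_rpow h2, lp.norm_eq_tsum_rpow h2]
    congr 1
    rw [← e.tsum_eq fun i => ‖ψ i‖ ^ (2 : ℝ≥0∞).toReal]
    refine tsum_congr fun i => ?_
    change ‖c i * ψ (e i)‖ ^ _ = _
    rw [norm_mul, hc, one_mul]

theorem weightedShift_apply (c : ι → ℂ) (hc : ∀ i, ‖c i‖ = 1) (e : ι ≃ ι) (ψ : ℓ^2(ι, ℂ)) (i : ι) :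
    weightedShift c hc e ψ i = c i * ψ (e i) := rfl

end WeightedShift

/-- The Hilbert space with orthonormal basis `|f⟩`, `f ∈ Hom₀(C,G)^0`.  For every finite set `Λ` of
simplices it contains `H_Λ = ⨂_{x ∈ Λ} L²(G_{dim x})` as a tensor factor, and it carries the faithful
representation of the local matrix algebras in which the quasi-local algebra is realized below. -/
abbrev Fock : Type (max u w) := ℓ^2(Hom₀ K G 0, ℂ)

/-- The bounded operators on that Hilbert space. -/
abbrev Op : Type (max u w) := Fock K G →L[ℂ] Fock K G

/-- The shift operator `P_t |f⟩ = |t + f⟩`, that is, `(P_t ψ)(f) = ψ(f - t)`. -/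
def shiftOp (t : Hom₀ K G 0) : Op K G :=
  (weightedShift (fun _ => 1) (fun _ => by simp) (Equiv.subRight t)).toContinuousLinearMap

/-- The clock operator `Q_γ |f⟩ = γ(f) |f⟩`. -/
def clockOp (γ : HomDual₀ K G 0) : Op K G :=
  (weightedShift (fun f : Hom₀ K G 0 => pairing 0 γ.1 f.1) (fun _ => norm_pairing _ _ _)
    (Equiv.refl _)).toContinuousLinearMap

/-- The index set of the canonical basis of `H_Λ = ⨂_{x ∈ Λ} L²(G_{dim x})`. -/
abbrev LocalCfg (Λ : Finset K.Simplex) : Type (max u w) := ∀ x : Λ, G.grp (dim x.1)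

variable {K G} in
/-- The restriction `f|_Λ`. -/
def restrictTo (Λ : Finset K.Simplex) (f : Hom₀ K G 0) : LocalCfg K G Λ :=
  fun x => f.1 x.1 (dim x.1)

variable {K G} in
/-- The configuration equal to `h` on `Λ` and to `f` outside `Λ`. -/
def overwrite (Λ : Finset K.Simplex) (h : LocalCfg K G Λ) (f : Hom₀ K G 0) : Hom₀ K G 0 :=
  ⟨Finsupp.onFinset (Λ ∪ f.1.support)
    (fun x => if hx : x ∈ Λ then Pi.single (dim x) (h ⟨x, hx⟩) else f.1 x) (fun x hx => by
      by_contra hc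
      simp only [Finset.mem_union, Finsupp.mem_support_iff, not_or, not_not] at hc
      exact hx (by rw [dif_neg hc.1, hc.2])), fun x j hj => by
    rw [Finsupp.onFinset_apply]
    split_ifs with hx
    · exact Pi.single_eq_of_ne (by simpa using hj) _
    · exact f.2 x j hj⟩

/-- The local algebra `𝔄_Λ ≅ B(H_Λ)`: the operators `a ⊗ 1` where `a` is a matrix over the canonical
basis of `H_Λ`, that is, `⟨f|(a ⊗ 1)|f'⟩ = a(f|_Λ, f'|_Λ)` if `f = f'` outside `Λ` and `0` otherwise. -/
def localAlgebra (Λ : Finset K.Simplex) : Set (Op K G) :=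
  {T | ∃ a : Matrix (LocalCfg K G Λ) (LocalCfg K G Λ) ℂ, ∀ (ψ : Fock K G) (f : Hom₀ K G 0),
    T ψ f = ∑ h, a (restrictTo Λ f) h * ψ (overwrite Λ h f)}

/-- The quasi-local algebra `𝔄`: the C*-algebra generated by all local algebras `𝔄_Λ`. -/
def quasiLocal : StarSubalgebra ℂ (Op K G) :=
  (StarAlgebra.adjoin ℂ (⋃ Λ, localAlgebra K G Λ)).topologicalClosure

/-- The quasi-local algebra `𝔄` as a type. -/
def QuasiLocal : Type (max u w) := quasiLocal K G

/-- The quasi-local algebra `𝔄` is a C*-algebra. -/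
def QuasiLocal.cstarAlgebra : CStarAlgebra (QuasiLocal K G) :=
  StarSubalgebra.cstarAlgebra (quasiLocal K G)
    (h_closed := StarSubalgebra.isClosed_topologicalClosure _)

instance : CStarAlgebra (QuasiLocal K G) := QuasiLocal.cstarAlgebra K G

variable {K G} in
/-- The inclusion of `𝔄` into the bounded operators. -/
def QuasiLocal.val : QuasiLocal K G →⋆ₐ[ℂ] Op K G := (quasiLocal K G).subtype

variable {K G} in
/-- An operator in the quasi-local algebra, as an element of the type `QuasiLocal K G`. -/
def QuasiLocal.mk (T : Op K G) (hT : T ∈ quasiLocal K G) : QuasiLocal K G := ⟨T, hT⟩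

variable {K G} in
theorem QuasiLocal.ext {S T : QuasiLocal K G} (h : S.val = T.val) : S = T := Subtype.ext h

variable {K G} in
theorem QuasiLocal.val_mk (T : Op K G) (hT : T ∈ quasiLocal K G) : (QuasiLocal.mk T hT).val = T :=
  rfl

variable {K G} in
theorem QuasiLocal.norm_val (T : QuasiLocal K G) : ‖T.val‖ = ‖T‖ := rfl

variable {K G} in
theorem QuasiLocal.val_mem (T : QuasiLocal K G) : T.val ∈ quasiLocal K G := Subtype.property T

/-- The local observables `𝔄_loc = ⋃_Λ 𝔄_Λ` as elements of `𝔄`. -/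
def localObservables : Set (QuasiLocal K G) := {T | ∃ Λ, T.val ∈ localAlgebra K G Λ}

section Operators

variable {K G}

theorem shiftOp_apply (t : Hom₀ K G 0) (ψ : Fock K G) (f : Hom₀ K G 0) :
    shiftOp K G t ψ f = ψ (f - t) := one_mul _

theorem clockOp_apply (γ : HomDual₀ K G 0) (ψ : Fock K G) (f : Hom₀ K G 0) :
    clockOp K G γ ψ f = pairing 0 γ.1 f.1 * ψ f := rfl

theorem op_ext {S T : Op K G} (h : ∀ ψ f, S ψ f = T ψ f) : S = T :=
  ContinuousLinearMap.ext fun ψ => lp.ext (funext fun f => h ψ f)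

theorem shiftOp_mul (s t : Hom₀ K G 0) : shiftOp K G s * shiftOp K G t = shiftOp K G (s + t) :=
  op_ext fun ψ f => by
    rw [mul_apply_eq_comp, shiftOp_apply, shiftOp_apply, shiftOp_apply, sub_sub]

theorem clockOp_mul (γ ν : HomDual₀ K G 0) :
    clockOp K G γ * clockOp K G ν = clockOp K G (γ + ν) :=
  op_ext fun ψ f => by
    rw [mul_apply_eq_comp, clockOp_apply, clockOp_apply, clockOp_apply,
      AddSubgroup.coe_add, pairing_add_left, mul_assoc]

theorem shiftOp_zero : shiftOp K G 0 = 1 :=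
  op_ext fun ψ f => by rw [shiftOp_apply, sub_zero]; rfl

theorem clockOp_zero : clockOp K G 0 = 1 :=
  op_ext fun ψ f => by
    rw [clockOp_apply, AddSubgroup.coe_zero, pairing_zero_left, one_mul]; rfl

theorem clockOp_mul_shiftOp (γ : HomDual₀ K G 0) (t : Hom₀ K G 0) :
    clockOp K G γ * shiftOp K G t = pairing 0 γ.1 t.1 • (shiftOp K G t * clockOp K G γ) :=
  op_ext fun ψ f => by
    have h : f.1 = t.1 + (f - t).1 := by simp
    change pairing 0 γ.1 f.1 * shiftOp K G t ψ f
      = pairing 0 γ.1 t.1 * shiftOp K G t (clockOp K G γ ψ) f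
    rw [shiftOp_apply, shiftOp_apply, clockOp_apply, ← mul_assoc, ← pairing_add_right, ← h]

theorem star_eq_of_isometry (U : Fock K G →ₗᵢ[ℂ] Fock K G) (S : Op K G)
    (h : U.toContinuousLinearMap * S = 1) : star U.toContinuousLinearMap = S := by
  have h1 : star U.toContinuousLinearMap * U.toContinuousLinearMap = 1 :=
    (ContinuousLinearMap.norm_map_iff_adjoint_comp_self _).1 U.norm_map
  calc star U.toContinuousLinearMap
      = star U.toContinuousLinearMap * (U.toContinuousLinearMap * S) := by rw [h, mul_one]
    _ = S := by rw [← mul_assoc, h1, one_mul]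

theorem star_shiftOp (t : Hom₀ K G 0) : star (shiftOp K G t) = shiftOp K G (-t) :=
  star_eq_of_isometry _ _ (by
    change shiftOp K G t * _ = _
    rw [shiftOp_mul, add_neg_cancel, shiftOp_zero])

theorem star_clockOp (γ : HomDual₀ K G 0) : star (clockOp K G γ) = clockOp K G (-γ) :=
  star_eq_of_isometry _ _ (by
    change clockOp K G γ * _ = _
    rw [clockOp_mul, add_neg_cancel, clockOp_zero])

theorem norm_shiftOp_le (t : Hom₀ K G 0) : ‖shiftOp K G t‖ ≤ 1 :=
  LinearIsometry.norm_toContinuousLinearMap_le _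

theorem norm_clockOp_le (γ : HomDual₀ K G 0) : ‖clockOp K G γ‖ ≤ 1 :=
  LinearIsometry.norm_toContinuousLinearMap_le _

theorem overwrite_apply (Λ : Finset K.Simplex) (h : LocalCfg K G Λ) (f : Hom₀ K G 0)
    (x : K.Simplex) : (overwrite Λ h f).1 x
      = if hx : x ∈ Λ then Pi.single (dim x) (h ⟨x, hx⟩) else f.1 x := rfl

theorem eq_single (f : Hom₀ K G 0) (x : K.Simplex) :
    f.1 x = Pi.single (dim x) (f.1 x (dim x)) := by
  funext j
  rcases eq_or_ne j (dim x) with rfl | hj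
  · simp
  · rw [Pi.single_eq_of_ne hj, f.2 x j (by simpa using hj)]

theorem dual_eq_single (γ : HomDual₀ K G 0) (x : K.Simplex) :
    γ.1 x = Pi.single (dim x) (γ.1 x (dim x)) := by
  funext j
  rcases eq_or_ne j (dim x) with rfl | hj
  · simp
  · rw [Pi.single_eq_of_ne hj, γ.2 x j (by simpa using hj)]

theorem overwrite_eq_sub (Λ : Finset K.Simplex) (h : LocalCfg K G Λ) (f : Hom₀ K G 0) :
    overwrite Λ h f = f - overwrite Λ (restrictTo Λ f - h) 0 := by
  refine Subtype.ext (Finsupp.ext fun x => ?_)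
  rw [AddSubgroup.coe_sub, Finsupp.sub_apply, overwrite_apply, overwrite_apply]
  split_ifs with hx
  · conv_rhs => rw [eq_single f x]
    rw [← Pi.single_sub]
    simp [restrictTo]
  · simp

theorem overwrite_sub_restrict (t f : Hom₀ K G 0) (Λ : Finset K.Simplex) (ht : t.1.support ⊆ Λ) :
    overwrite Λ (restrictTo Λ f - restrictTo Λ t) f = f - t := by
  refine Subtype.ext (Finsupp.ext fun x => ?_)
  rw [AddSubgroup.coe_sub, Finsupp.sub_apply, overwrite_apply]
  split_ifs with hx
  · rw [eq_single f x, eq_single t x, ← Pi.single_sub]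
    simp [restrictTo]
  · have : t.1 x = 0 := by
      by_contra hc
      exact hx (ht (Finsupp.mem_support_iff.2 hc))
    rw [this, sub_zero]

theorem pairing_eq_prod (γ : HomDual₀ K G 0) (f : Hom₀ K G 0) (Λ : Finset K.Simplex)
    (hγ : γ.1.support ⊆ Λ) :
    pairing 0 γ.1 f.1 = ∏ x : Λ, γ.1 x.1 (dim x.1) (restrictTo Λ f x) := by
  classical
  have h0 : ∀ (x : K.Simplex) (j : ℤ), j = dim x → γ.1 x j (f.1 x j)
      = γ.1 x (dim x) (f.1 x (dim x)) := by rintro x _ rfl; rfl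
  unfold pairing Finsupp.prod
  rw [Finset.prod_congr rfl fun x _ => h0 x _ (sub_zero _)]
  have h1 : ∏ x ∈ f.1.support, γ.1 x (dim x) (f.1 x (dim x))
      = ∏ x ∈ f.1.support ∪ Λ, γ.1 x (dim x) (f.1 x (dim x)) :=
    Finset.prod_subset Finset.subset_union_left fun x _ hx => by
      simp only [Finsupp.mem_support_iff, not_not] at hx
      simp [hx, dual_map_zero]
  have h2 : ∏ x ∈ Λ, γ.1 x (dim x) (f.1 x (dim x))
      = ∏ x ∈ f.1.support ∪ Λ, γ.1 x (dim x) (f.1 x (dim x)) :=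
    Finset.prod_subset Finset.subset_union_right fun x _ hx => by
      have : γ.1 x = 0 := by
        by_contra hc
        exact hx (hγ (Finsupp.mem_support_iff.2 hc))
      simp [this, dual_zero_apply]
  rw [h1, ← h2, ← Finset.prod_coe_sort]
  rfl

theorem shiftOp_mem_localAlgebra (t : Hom₀ K G 0) (Λ : Finset K.Simplex) (ht : t.1.support ⊆ Λ) :
    shiftOp K G t ∈ localAlgebra K G Λ := by
  classical
  refine ⟨fun g h => if h = g - restrictTo Λ t then 1 else 0, fun ψ f => ?_⟩
  simp only [ite_mul, one_mul, zero_mul, Finset.sum_ite_eq', Finset.mem_univ, if_true]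
  rw [overwrite_sub_restrict t f Λ ht, shiftOp_apply]

theorem clockOp_mem_localAlgebra (γ : HomDual₀ K G 0) (Λ : Finset K.Simplex)
    (hγ : γ.1.support ⊆ Λ) : clockOp K G γ ∈ localAlgebra K G Λ := by
  classical
  refine ⟨fun g h => if h = g then ∏ x : Λ, γ.1 x.1 (dim x.1) (g x) else 0, fun ψ f => ?_⟩
  simp only [ite_mul, zero_mul, Finset.sum_ite_eq', Finset.mem_univ, if_true]
  have h := overwrite_sub_restrict (0 : Hom₀ K G 0) f Λ (by simp)
  have h0 : restrictTo Λ (0 : Hom₀ K G 0) = 0 := rfl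
  rw [h0, sub_zero, sub_zero] at h
  rw [h, clockOp_apply, pairing_eq_prod γ f Λ hγ]

theorem localAlgebra_subset (Λ : Finset K.Simplex) :
    localAlgebra K G Λ ⊆ quasiLocal K G := fun _ hT =>
  StarSubalgebra.le_topologicalClosure _
    (StarAlgebra.subset_adjoin ℂ _ (Set.mem_iUnion.2 ⟨Λ, hT⟩))

end Operators

/-- The shift operator `P_t` as an element of `𝔄`. -/
def P (t : Hom₀ K G 0) : QuasiLocal K G :=
  QuasiLocal.mk (shiftOp K G t) (localAlgebra_subset _ (shiftOp_mem_localAlgebra t _ subset_rfl))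

/-- The clock operator `Q_γ` as an element of `𝔄`. -/
def Q (γ : HomDual₀ K G 0) : QuasiLocal K G :=
  QuasiLocal.mk (clockOp K G γ) (localAlgebra_subset _ (clockOp_mem_localAlgebra γ _ subset_rfl))

/-! ### The star and plaquette operators, the dynamics and the ground states -/

/-- `A_t = P_{δ^{-1} t}` for `t ∈ Hom₀(C,G)^{-1}`. -/
def A (t : Hom₀ K G (-1)) : QuasiLocal K G := P K G (coboundary K G (-1) 0 (by norm_num) t)

/-- `B_γ = Q_{δ_1 γ}` for `γ ∈ Hom₀(C,G)_1`. -/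
def B (γ : HomDual₀ K G 1) : QuasiLocal K G := Q K G (boundary K G 1 0 (by norm_num) γ)

/-- The star operator `A_x^0`, the mean of the `A_{x^*_g}` over `g ∈ G_{n+1}`, `n = dim x`. -/
def starOp (x : K.Simplex) : QuasiLocal K G :=
  ((Fintype.card (G.grp (dim x - -1)) : ℂ)⁻¹) •
    ∑ g : G.grp (dim x - -1), A K G (localMap K G (-1) x g)

/-- The plaquette operator `B_x^0`, the mean of the `B_{x_*^α}` over `α ∈ Ĝ_{n-1}`, `n = dim x`. -/
def plaquetteOp (x : K.Simplex) : QuasiLocal K G :=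
  ((Fintype.card (G.grp (dim x - 1)) : ℂ)⁻¹) •
    ∑ α : G.dual (dim x - 1), B K G (localDualMap K G 1 x α)

variable {K} in
/-- The support of `A_x^0`: the simplex `x` and its coboundary. -/
def starSupport (x : K.Simplex) : Set K.Simplex := {x} ∪ {z | incidence z x ≠ 0}

variable {K} in
/-- The support of `B_x^0`: the simplex `x` and its boundary. -/
def plaquetteSupport (x : K.Simplex) : Set K.Simplex := {x} ∪ {y | incidence x y ≠ 0}

open scoped Classical in
/-- The local Hamiltonian `H^Λ`; every simplex whose star or plaquette is contained in `Λ` belongs to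
`Λ` itself. -/
def localHamiltonian (Λ : Finset K.Simplex) : QuasiLocal K G :=
  -(∑ x ∈ Λ with starSupport x ⊆ (Λ : Set K.Simplex), starOp K G x
    + ∑ x ∈ Λ with plaquetteSupport x ⊆ (Λ : Set K.Simplex), plaquetteOp K G x)

/-- The derivation `δ_QDM(T) = i [H^Λ, T]`, `Λ` large: the limit over the net of finite sets `Λ`.
For a local observable `T` the net is eventually constant, see `derivation_eventually`. -/
def derivation (T : QuasiLocal K G) : QuasiLocal K G :=
  limUnder atTop fun Λ : Finset K.Simplex =>
    Complex.I • (localHamiltonian K G Λ * T - T * localHamiltonian K G Λ)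

section Derivation

variable {K G}

theorem overwrite_sub (Λ : Finset K.Simplex) (h : LocalCfg K G Λ) (f t : Hom₀ K G 0)
    (ht : ∀ x ∈ Λ, t.1 x = 0) : overwrite Λ h (f - t) = overwrite Λ h f - t := by
  refine Subtype.ext (Finsupp.ext fun x => ?_)
  rw [AddSubgroup.coe_sub, Finsupp.sub_apply, overwrite_apply, overwrite_apply]
  split_ifs with hx
  · rw [ht x hx, sub_zero]
  · simp

theorem commute_shiftOp {T : Op K G} {Λ : Finset K.Simplex} (hT : T ∈ localAlgebra K G Λ)
    (t : Hom₀ K G 0) (ht : ∀ x ∈ Λ, t.1 x = 0) : shiftOp K G t * T = T * shiftOp K G t := by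
  obtain ⟨a, ha⟩ := hT
  refine op_ext fun ψ f => ?_
  rw [mul_apply_eq_comp, mul_apply_eq_comp, shiftOp_apply, ha, ha]
  refine Finset.sum_congr rfl fun h _ => ?_
  have : restrictTo Λ (f - t) = restrictTo Λ f := by
    funext x; simp [restrictTo, ht x.1 x.2]
  rw [shiftOp_apply, overwrite_sub Λ h f t ht, this]

theorem commute_clockOp {T : Op K G} {Λ : Finset K.Simplex} (hT : T ∈ localAlgebra K G Λ)
    (γ : HomDual₀ K G 0) (hγ : ∀ x ∈ Λ, γ.1 x = 0) : clockOp K G γ * T = T * clockOp K G γ := by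
  obtain ⟨a, ha⟩ := hT
  refine op_ext fun ψ f => ?_
  rw [mul_apply_eq_comp, mul_apply_eq_comp, clockOp_apply, ha, ha, Finset.mul_sum]
  refine Finset.sum_congr rfl fun h _ => ?_
  have : pairing 0 γ.1 (overwrite Λ h f).1 = pairing 0 γ.1 f.1 := by
    rw [pairing_eq_prod γ _ _ subset_rfl, pairing_eq_prod γ _ _ subset_rfl]
    refine Finset.prod_congr rfl fun x _ => ?_
    have hx : x.1 ∉ Λ := fun hc => Finsupp.mem_support_iff.1 x.2 (hγ _ hc)
    simp [restrictTo, overwrite_apply, hx]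
  rw [clockOp_apply, this, mul_left_comm]

theorem coboundary_localMap_eq_zero (x y : K.Simplex) (g : G.grp (dim x - -1))
    (hy : y ∉ starSupport x) :
    (coboundary K G (-1) 0 (by norm_num) (localMap K G (-1) x g)).1 y = 0 := by
  simp only [starSupport, Set.mem_union, Set.mem_singleton_iff, Set.mem_ofPred_eq, not_or,
    not_not] at hy
  funext j
  change coboundaryTotal K G (-1) (Finsupp.single x _) y j = 0
  rw [coboundaryTotal_apply, Finsupp.sum_single_index (by simp), hy.2,
    Finsupp.single_eq_of_ne hy.1]
  simp

theorem boundary_localDualMap_eq_zero (x y : K.Simplex) (α : G.dual (dim x - 1))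
    (hy : y ∉ plaquetteSupport x) :
    (boundary K G 1 0 (by norm_num) (localDualMap K G 1 x α)).1 y = 0 := by
  simp only [plaquetteSupport, Set.mem_union, Set.mem_singleton_iff, Set.mem_ofPred_eq, not_or,
    not_not] at hy
  funext j
  change boundaryTotal K G 1 (Finsupp.single x _) y j = 0
  rw [boundaryTotal_apply, Finsupp.sum_single_index (by simp), hy.2,
    Finsupp.single_eq_of_ne hy.1]
  simp

theorem finite_starSupport (x : K.Simplex) : (starSupport x).Finite :=
  (Set.finite_singleton x).union (finite_cofaces x)

theorem finite_plaquetteSupport (x : K.Simplex) : (plaquetteSupport x).Finite :=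
  (Set.finite_singleton x).union (finite_faces x)

theorem commute_starOp {T : QuasiLocal K G} {Λ : Finset K.Simplex}
    (hT : T.val ∈ localAlgebra K G Λ) (x : K.Simplex) (hx : Disjoint (starSupport x) Λ) :
    starOp K G x * T - T * starOp K G x = 0 := by
  rw [sub_eq_zero, starOp, smul_mul_assoc, mul_smul_comm, Finset.sum_mul, Finset.mul_sum]
  congr 1
  refine Finset.sum_congr rfl fun g _ => QuasiLocal.ext ?_
  exact commute_shiftOp hT _ fun y hy =>
    coboundary_localMap_eq_zero x y g fun hc => Set.disjoint_left.1 hx hc hy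

theorem commute_plaquetteOp {T : QuasiLocal K G} {Λ : Finset K.Simplex}
    (hT : T.val ∈ localAlgebra K G Λ) (x : K.Simplex) (hx : Disjoint (plaquetteSupport x) Λ) :
    plaquetteOp K G x * T - T * plaquetteOp K G x = 0 := by
  rw [sub_eq_zero, plaquetteOp, smul_mul_assoc, mul_smul_comm, Finset.sum_mul, Finset.mul_sum]
  congr 1
  refine Finset.sum_congr rfl fun g _ => QuasiLocal.ext ?_
  exact commute_clockOp hT _ fun y hy =>
    boundary_localDualMap_eq_zero x y g fun hc => Set.disjoint_left.1 hx hc hy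

open scoped Classical in
theorem eventually_sum_comm {R : Type*} [Ring R] (supp : K.Simplex → Set K.Simplex)
    (hself : ∀ x, x ∈ supp x) (hfin : ∀ x, (supp x).Finite) (op : K.Simplex → R) (T : R)
    (Λ₀ : Finset K.Simplex) (hmeet : {x | ¬ Disjoint (supp x) Λ₀}.Finite)
    (hcomm : ∀ x, Disjoint (supp x) Λ₀ → op x * T - T * op x = 0) :
    ∀ᶠ Λ : Finset K.Simplex in atTop,
      (∑ x ∈ Λ with supp x ⊆ (Λ : Set K.Simplex), op x) * T
        - T * ∑ x ∈ Λ with supp x ⊆ (Λ : Set K.Simplex), op x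
      = ∑ x ∈ hmeet.toFinset, (op x * T - T * op x) := by
  have hbig : (⋃ x ∈ {x | ¬ Disjoint (supp x) Λ₀}, supp x).Finite :=
    hmeet.biUnion fun x _ => hfin x
  filter_upwards [eventually_ge_atTop hbig.toFinset] with Λ hΛ
  rw [Finset.sum_mul, Finset.mul_sum, ← Finset.sum_sub_distrib]
  symm
  have hsub : ∀ x ∈ hmeet.toFinset, supp x ⊆ (Λ : Set K.Simplex) := fun x hx y hy =>
    hΛ (hbig.mem_toFinset.2 (Set.mem_biUnion (hmeet.mem_toFinset.1 hx) hy))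
  refine Finset.sum_subset (fun x hx => Finset.mem_filter.2 ⟨hsub x hx (hself x), hsub x hx⟩)
    fun x _ hx => hcomm x ?_
  by_contra hc
  exact hx (hmeet.mem_toFinset.2 hc)

theorem finite_meet_star (Λ : Finset K.Simplex) :
    {x : K.Simplex | ¬ Disjoint (starSupport x) Λ}.Finite := by
  refine (Λ.finite_toSet.union (Λ.finite_toSet.biUnion fun z _ => finite_faces z)).subset
    fun x hx => ?_
  obtain ⟨z, hz, hzΛ⟩ := Set.not_disjoint_iff.1 hx
  rcases hz with rfl | hz
  · exact Or.inl hzΛ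
  · exact Or.inr (Set.mem_biUnion hzΛ hz)

theorem finite_meet_plaquette (Λ : Finset K.Simplex) :
    {x : K.Simplex | ¬ Disjoint (plaquetteSupport x) Λ}.Finite := by
  refine (Λ.finite_toSet.union (Λ.finite_toSet.biUnion fun z _ => finite_cofaces z)).subset
    fun x hx => ?_
  obtain ⟨z, hz, hzΛ⟩ := Set.not_disjoint_iff.1 hx
  rcases hz with rfl | hz
  · exact Or.inl hzΛ
  · exact Or.inr (Set.mem_biUnion hzΛ hz)

/-- On a local observable, `δ_QDM(T) = i [H^Λ, T]` for all sufficiently large finite `Λ`. -/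
theorem derivation_eventually (T : QuasiLocal K G) (hT : T ∈ localObservables K G) :
    ∀ᶠ Λ : Finset K.Simplex in atTop, derivation K G T
      = Complex.I • (localHamiltonian K G Λ * T - T * localHamiltonian K G Λ) := by
  obtain ⟨Λ₀, hT⟩ := hT
  have h1 := eventually_sum_comm starSupport (fun x => Or.inl rfl) finite_starSupport
    (starOp K G) T Λ₀ (finite_meet_star Λ₀) (commute_starOp hT)
  have h2 := eventually_sum_comm plaquetteSupport (fun x => Or.inl rfl) finite_plaquetteSupport
    (plaquetteOp K G) T Λ₀ (finite_meet_plaquette Λ₀) (commute_plaquetteOp hT)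
  have h : ∀ᶠ Λ : Finset K.Simplex in atTop,
      Complex.I • (localHamiltonian K G Λ * T - T * localHamiltonian K G Λ)
      = Complex.I • -(∑ x ∈ (finite_meet_star Λ₀).toFinset, (starOp K G x * T - T * starOp K G x)
        + ∑ x ∈ (finite_meet_plaquette Λ₀).toFinset,
          (plaquetteOp K G x * T - T * plaquetteOp K G x)) := by
    filter_upwards [h1, h2] with Λ h1 h2
    rw [← h1, ← h2, localHamiltonian]
    congr 1
    noncomm_ring
  have hlim := (tendsto_congr' h).2 tendsto_const_nhds
  have : derivation K G T = _ := hlim.limUnder_eq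
  filter_upwards [h] with Λ hΛ
  rw [hΛ, this]

end Derivation

/-- The state space of a topological *-algebra: the positive normalized continuous linear
functionals, with the weak-* topology.  (On a C*-algebra positivity implies continuity.) -/
def stateSpace (R : Type*) [Ring R] [StarRing R] [Algebra ℂ R] [TopologicalSpace R] :
    Set (WeakDual ℂ R) :=
  {ω | (∀ a : R, 0 ≤ ω (star a * a)) ∧ ω 1 = 1}

/-- The pure states: the extreme points of the state space. -/
def pureStates (R : Type*) [Ring R] [StarRing R] [Algebra ℂ R] [TopologicalSpace R] :
    Set (WeakDual ℂ R) :=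
  (stateSpace R).extremePoints ℝ

/-- The ground states of the dynamics: `-i ω(T* δ_QDM(T)) ≥ 0` for all local observables `T`. -/
def groundStates : Set (WeakDual ℂ (QuasiLocal K G)) :=
  {ω | ω ∈ stateSpace (QuasiLocal K G) ∧
    ∀ T ∈ localObservables K G, 0 ≤ -Complex.I * ω (star T * derivation K G T)}

/-- The frustration-free ground states. -/
def ffGroundStates : Set (WeakDual ℂ (QuasiLocal K G)) :=
  {ω | ω ∈ groundStates K G ∧ ∀ x y : K.Simplex, ω (starOp K G x) = 1 ∧ ω (plaquetteOp K G y) = 1}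

/-- The pure frustration-free ground states. -/
def pureFFGroundStates : Set (WeakDual ℂ (QuasiLocal K G)) :=
  ffGroundStates K G ∩ pureStates (QuasiLocal K G)

/-! ### The core algebra, the fixing algebra, and the algebra of logical operators -/

/-- The core algebra `𝔎`, generated by all `A_t` and `B_γ`. -/
def coreAlgebra : StarSubalgebra ℂ (QuasiLocal K G) :=
  (StarAlgebra.adjoin ℂ (Set.range (A K G) ∪ Set.range (B K G))).topologicalClosure

/-- The fixing algebra `𝔎'`, the commutant of `𝔎` in `𝔄`. -/
def fixingAlgebra : StarSubalgebra ℂ (QuasiLocal K G) :=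
  StarSubalgebra.centralizer ℂ (coreAlgebra K G : Set (QuasiLocal K G))

/-- The cocycles in `Hom₀(C,G)^0`. -/
def cocycles : AddSubgroup (Hom₀ K G 0) := (coboundary K G 0 1 (by norm_num)).ker

/-- The coboundaries in `Hom₀(C,G)^0`. -/
def coboundaries : AddSubgroup (Hom₀ K G 0) := (coboundary K G (-1) 0 (by norm_num)).range

/-- The cycles in `Hom₀(C,G)_0`. -/
def cycles : AddSubgroup (HomDual₀ K G 0) := (boundary K G 0 (-1) (by norm_num)).ker

/-- The boundaries in `Hom₀(C,G)_0`. -/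
def boundaries : AddSubgroup (HomDual₀ K G 0) := (boundary K G 1 0 (by norm_num)).range

/-- The differences `P_t Q_γ - P_{t'} Q_{γ'}` where `t, t'` are cohomologous cocycles and `γ, γ'`
are homologous cycles. -/
def redundancies : Set (fixingAlgebra K G) :=
  {d | ∃ t ∈ cocycles K G, ∃ t' ∈ cocycles K G, ∃ γ ∈ cycles K G, ∃ γ' ∈ cycles K G,
    t - t' ∈ coboundaries K G ∧ γ - γ' ∈ boundaries K G ∧
    (d : QuasiLocal K G) = P K G t * Q K G γ - P K G t' * Q K G γ'}

/-- The redundancy space `𝔍`: the closed linear span of these differences in `𝔎'`. -/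
def redundancySpace : Submodule ℂ (fixingAlgebra K G) :=
  (Submodule.span ℂ (redundancies K G)).topologicalClosure

section Ideal

variable {K G}

theorem mul_mem_span {R : Type*} [Ring R] [Algebra ℂ R] {S T U : Set R}
    (h : ∀ x ∈ S, ∀ y ∈ T, x * y ∈ Submodule.span ℂ U) {x y : R}
    (hx : x ∈ Submodule.span ℂ S) (hy : y ∈ Submodule.span ℂ T) :
    x * y ∈ Submodule.span ℂ U := by
  have := Submodule.mul_mem_mul hx hy
  rw [Submodule.span_mul_span] at this
  refine Submodule.span_le.2 ?_ this
  rintro _ ⟨w, hw, e, he, rfl⟩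
  exact h w hw e he

theorem star_mem_span {R : Type*} [Ring R] [StarRing R] [Algebra ℂ R] [StarModule ℂ R] {S : Set R}
    (h : ∀ x ∈ S, star x ∈ Submodule.span ℂ S) {x : R} (hx : x ∈ Submodule.span ℂ S) :
    star x ∈ Submodule.span ℂ S := by
  induction hx using Submodule.span_induction with
  | mem x hx => exact h x hx
  | zero => rw [star_zero]; exact Submodule.zero_mem _
  | add x y _ _ hx hy => rw [star_add]; exact Submodule.add_mem _ hx hy
  | smul c x _ hx => rw [star_smul]; exact Submodule.smul_mem _ _ hx

/-- The monomial `P_t Q_γ`. -/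
def monomial (i : Hom₀ K G 0 × HomDual₀ K G 0) : QuasiLocal K G := P K G i.1 * Q K G i.2

theorem P_mul (s t : Hom₀ K G 0) : P K G s * P K G t = P K G (s + t) :=
  QuasiLocal.ext (shiftOp_mul s t)

theorem Q_mul (γ ν : HomDual₀ K G 0) : Q K G γ * Q K G ν = Q K G (γ + ν) :=
  QuasiLocal.ext (clockOp_mul γ ν)

theorem P_zero : P K G 0 = 1 := QuasiLocal.ext shiftOp_zero

theorem Q_zero : Q K G 0 = 1 := QuasiLocal.ext clockOp_zero

theorem Q_mul_P (γ : HomDual₀ K G 0) (t : Hom₀ K G 0) :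
    Q K G γ * P K G t = pairing 0 γ.1 t.1 • (P K G t * Q K G γ) :=
  QuasiLocal.ext (clockOp_mul_shiftOp γ t)

theorem star_P (t : Hom₀ K G 0) : star (P K G t) = P K G (-t) := QuasiLocal.ext (star_shiftOp t)

theorem star_Q (γ : HomDual₀ K G 0) : star (Q K G γ) = Q K G (-γ) := QuasiLocal.ext (star_clockOp γ)

theorem monomial_mul (i j : Hom₀ K G 0 × HomDual₀ K G 0) :
    monomial i * monomial j = pairing 0 i.2.1 j.1.1 • monomial (i + j) := by
  unfold monomial
  calc P K G i.1 * Q K G i.2 * (P K G j.1 * Q K G j.2)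
      = P K G i.1 * (Q K G i.2 * P K G j.1) * Q K G j.2 := by noncomm_ring
    _ = _ := by
      rw [Q_mul_P, mul_smul_comm, smul_mul_assoc, ← mul_assoc, P_mul, mul_assoc, Q_mul]
      rfl

theorem pairing_neg_neg (p : ℤ) (γ : K.Simplex →₀ ∀ j, G.dual j) (t : K.Simplex →₀ ∀ j, G.grp j) :
    pairing p (-γ) (-t) = pairing p γ t := by
  have h1 := pairing_add_left p γ (-γ) (-t)
  have h2 := pairing_add_right p γ t (-t)
  rw [add_neg_cancel, pairing_zero_left] at h1
  rw [add_neg_cancel, pairing_zero_right] at h2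
  have h3 : pairing p γ (-t) ≠ 0 := norm_ne_zero_iff.1 (by rw [norm_pairing]; norm_num)
  exact mul_left_cancel₀ h3 (by rw [← h1, h2, mul_comm])

theorem star_monomial (i : Hom₀ K G 0 × HomDual₀ K G 0) :
    star (monomial i) = pairing 0 i.2.1 i.1.1 • monomial (-i) := by
  unfold monomial
  rw [star_mul, star_P, star_Q, Q_mul_P]
  congr 1
  exact pairing_neg_neg 0 i.2.1 i.1.1

/-! #### The monomials span a dense subspace -/

/-- The dual map attached to a character of the group of configurations on `Λ`. -/
def dualOfChar (Λ : Finset K.Simplex) (χ : AddChar (LocalCfg K G Λ) ℂ) : HomDual₀ K G 0 :=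
  ⟨Finsupp.onFinset Λ
    (fun x => if hx : x ∈ Λ then Pi.single (dim x)
      (show G.dual (dim x) from
        χ.compAddMonoidHom (AddMonoidHom.single (fun x : Λ => G.grp (dim x.1)) ⟨x, hx⟩)) else 0)
    (fun x hx => by
      by_contra hc
      exact hx (dif_neg hc)), fun x j hj => by
    rw [Finsupp.onFinset_apply]
    split_ifs with hx
    · exact Pi.single_eq_of_ne (by simpa using hj) _
    · rfl⟩

theorem support_dualOfChar (Λ : Finset K.Simplex) (χ : AddChar (LocalCfg K G Λ) ℂ) :
    (dualOfChar Λ χ).1.support ⊆ Λ := fun x hx => by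
  by_contra hc
  refine Finsupp.mem_support_iff.1 hx ?_
  change (if hx : x ∈ Λ then Pi.single (M := G.dual) (dim x) _ else 0) = _
  rw [dif_neg hc]

theorem pairing_dualOfChar (Λ : Finset K.Simplex) (χ : AddChar (LocalCfg K G Λ) ℂ)
    (f : Hom₀ K G 0) : pairing 0 (dualOfChar Λ χ).1 f.1 = χ (restrictTo Λ f) := by
  classical
  rw [pairing_eq_prod (dualOfChar Λ χ) f Λ (support_dualOfChar Λ χ)]
  have h : ∀ x : Λ, (dualOfChar Λ χ).1 x.1 (dim x.1) (restrictTo Λ f x)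
      = χ (Pi.single x (restrictTo Λ f x)) := fun x => by
    have : (dualOfChar Λ χ).1 x.1 (dim x.1) = (show G.dual (dim x.1) from
        χ.compAddMonoidHom (AddMonoidHom.single (fun x : Λ => G.grp (dim x.1)) x)) := by
      change (if hx : x.1 ∈ Λ then Pi.single (M := G.dual) (dim x.1) _ else 0) (dim x.1) = _
      rw [dif_pos x.2, Pi.single_eq_same]
    rw [this]
    rfl
  rw [Finset.prod_congr rfl fun x _ => h x]
  conv_rhs => rw [← Finset.univ_sum_single (restrictTo Λ f)]
  exact (map_prod χ.toMonoidHom (fun x => Multiplicative.ofAdd (Pi.single x (restrictTo Λ f x)))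
    Finset.univ).symm

theorem localAlgebra_subset_span (Λ : Finset K.Simplex) : localAlgebra K G Λ ⊆
    Submodule.span ℂ (Set.range fun i : Hom₀ K G 0 × HomDual₀ K G 0 =>
      shiftOp K G i.1 * clockOp K G i.2) := by
  classical
  rintro T ⟨a, ha⟩
  have key : T = ∑ k : LocalCfg K G Λ, ∑ χ : AddChar (LocalCfg K G Λ) ℂ,
      (AddChar.complexBasis (LocalCfg K G Λ)).repr (fun g => a g (g - k)) χ •
        (clockOp K G (dualOfChar Λ χ) * shiftOp K G (overwrite Λ k 0)) := by
    refine op_ext fun ψ f => ?_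
    have hexp : ∀ k : LocalCfg K G Λ, ∑ χ : AddChar (LocalCfg K G Λ) ℂ,
        (AddChar.complexBasis (LocalCfg K G Λ)).repr (fun g => a g (g - k)) χ *
          χ (restrictTo Λ f) = a (restrictTo Λ f) (restrictTo Λ f - k) := fun k => by
      have := congr_fun ((AddChar.complexBasis (LocalCfg K G Λ)).sum_repr
        (fun g => a g (g - k))) (restrictTo Λ f)
      simpa [AddChar.complexBasis_apply, Finset.sum_apply] using this
    have hR : (∑ k : LocalCfg K G Λ, ∑ χ : AddChar (LocalCfg K G Λ) ℂ,
        (AddChar.complexBasis (LocalCfg K G Λ)).repr (fun g => a g (g - k)) χ •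
        (clockOp K G (dualOfChar Λ χ) * shiftOp K G (overwrite Λ k 0))) ψ f
        = ∑ k : LocalCfg K G Λ, a (restrictTo Λ f) (restrictTo Λ f - k) *
          ψ (f - overwrite Λ k 0) := by
      simp only [sum_apply, lp.coeFn_sum, Finset.sum_apply]
      refine Finset.sum_congr rfl fun k _ => ?_
      rw [← hexp k, Finset.sum_mul]
      refine Finset.sum_congr rfl fun χ _ => ?_
      change _ * (clockOp K G (dualOfChar Λ χ) (shiftOp K G (overwrite Λ k 0) ψ) f) = _
      rw [clockOp_apply, shiftOp_apply, pairing_dualOfChar, mul_assoc]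
    rw [ha, hR]
    rw [← (Equiv.subLeft (restrictTo Λ f)).sum_comp]
    refine Finset.sum_congr rfl fun k _ => ?_
    rw [overwrite_eq_sub Λ _ f]
    simp
  rw [key]
  refine Submodule.sum_mem _ fun k _ => Submodule.sum_mem _ fun χ _ => Submodule.smul_mem _ _ ?_
  rw [clockOp_mul_shiftOp]
  exact Submodule.smul_mem _ _ (Submodule.subset_span ⟨(_, _), rfl⟩)

theorem adjoin_subset_span {T : Op K G}
    (hT : T ∈ StarAlgebra.adjoin ℂ (⋃ Λ, localAlgebra K G Λ)) :
    T ∈ (Submodule.span ℂ (Set.range (monomial (K := K) (G := G)))).map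
      (QuasiLocal.val (K := K) (G := G)).toLinearMap := by
  have hrange : (Submodule.span ℂ (Set.range (monomial (K := K) (G := G)))).map
      (QuasiLocal.val (K := K) (G := G)).toLinearMap = Submodule.span ℂ (Set.range
        fun i : Hom₀ K G 0 × HomDual₀ K G 0 => shiftOp K G i.1 * clockOp K G i.2) := by
    rw [Submodule.map_span, ← Set.range_comp]
    rfl
  induction hT using StarAlgebra.adjoin_induction with
  | mem x hx =>
    obtain ⟨Λ, hΛ⟩ := Set.mem_iUnion.1 hx
    rw [hrange]
    exact localAlgebra_subset_span Λ hΛ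
  | algebraMap r =>
    refine ⟨r • monomial 0, Submodule.smul_mem _ _ (Submodule.subset_span ⟨0, rfl⟩), ?_⟩
    have : monomial (0 : Hom₀ K G 0 × HomDual₀ K G 0) = 1 := by
      simp [monomial, P_zero, Q_zero]
    rw [this]
    rfl
  | add x y _ _ hx hy => exact Submodule.add_mem _ hx hy
  | mul x y _ _ hx hy =>
    obtain ⟨x, hx, rfl⟩ := hx
    obtain ⟨y, hy, rfl⟩ := hy
    refine ⟨x * y, mul_mem_span ?_ hx hy, rfl⟩
    rintro _ ⟨i, rfl⟩ _ ⟨j, rfl⟩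
    rw [monomial_mul]
    exact Submodule.smul_mem _ _ (Submodule.subset_span ⟨_, rfl⟩)
  | star x _ hx =>
    obtain ⟨x, hx, rfl⟩ := hx
    refine ⟨star x, star_mem_span ?_ hx, rfl⟩
    rintro _ ⟨i, rfl⟩
    rw [star_monomial]
    exact Submodule.smul_mem _ _ (Submodule.subset_span ⟨_, rfl⟩)

theorem exists_approx (T : QuasiLocal K G) {ε : ℝ} (hε : 0 < ε) :
    ∃ R ∈ Submodule.span ℂ (Set.range (monomial (K := K) (G := G))), ‖T - R‖ < ε := by
  obtain ⟨S, hS, hd⟩ := Metric.mem_closure_iff.1 T.val_mem ε hε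
  obtain ⟨R, hR, rfl⟩ := adjoin_subset_span hS
  refine ⟨R, hR, ?_⟩
  rw [dist_eq_norm] at hd
  rw [← QuasiLocal.norm_val, map_sub]
  exact hd

/-! #### The fixing algebra is the closed span of the monomials it contains -/

theorem A_mul_monomial (s : Hom₀ K G (-1)) (i : Hom₀ K G 0 × HomDual₀ K G 0) :
    monomial i * A K G s
      = pairing 0 i.2.1 (coboundary K G (-1) 0 (by norm_num) s).1 • (A K G s * monomial i) := by
  unfold A monomial
  rw [mul_assoc, Q_mul_P, mul_smul_comm, ← mul_assoc, ← mul_assoc, P_mul, P_mul, add_comm]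

theorem B_mul_monomial (ν : HomDual₀ K G 1) (i : Hom₀ K G 0 × HomDual₀ K G 0) :
    B K G ν * monomial i
      = pairing 0 (boundary K G 1 0 (by norm_num) ν).1 i.1.1 • (monomial i * B K G ν) := by
  unfold B monomial
  rw [← mul_assoc, Q_mul_P, smul_mul_assoc, mul_assoc, mul_assoc, Q_mul, Q_mul, add_comm]

theorem pairing_coboundary (γ : HomDual₀ K G 0) (s : Hom₀ K G (-1)) :
    pairing 0 γ.1 (coboundary K G (-1) 0 (by norm_num) s).1
      = pairing (-1) (boundary K G 0 (-1) (by norm_num) γ).1 s.1 :=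
  pairing_coboundaryTotal (-1) γ.1 s.1

theorem pairing_boundary (ν : HomDual₀ K G 1) (t : Hom₀ K G 0) :
    pairing 0 (boundary K G 1 0 (by norm_num) ν).1 t.1
      = pairing 1 ν.1 (coboundary K G 0 1 (by norm_num) t).1 :=
  (pairing_coboundaryTotal 0 ν.1 t.1).symm

theorem pairing_coboundary_of_mem (γ : HomDual₀ K G 0) (hγ : γ ∈ cycles K G)
    (s : Hom₀ K G (-1)) :
    pairing 0 γ.1 (coboundary K G (-1) 0 (by norm_num) s).1 = 1 := by
  rw [pairing_coboundary, (AddMonoidHom.mem_ker).1 hγ]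
  exact pairing_zero_left _ _

theorem pairing_boundary_of_mem (ν : HomDual₀ K G 1) (t : Hom₀ K G 0) (ht : t ∈ cocycles K G) :
    pairing 0 (boundary K G 1 0 (by norm_num) ν).1 t.1 = 1 := by
  rw [pairing_boundary, (AddMonoidHom.mem_ker).1 ht]
  exact pairing_zero_right _ _

theorem exists_detect_cycle (γ : HomDual₀ K G 0) (hγ : γ ∉ cycles K G) :
    ∃ (s : Hom₀ K G (-1)) (m : ℕ), 0 < m ∧
      pairing 0 γ.1 (coboundary K G (-1) 0 (by norm_num) s).1 ≠ 1 ∧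
      pairing 0 γ.1 (coboundary K G (-1) 0 (by norm_num) s).1 ^ m = 1 := by
  obtain ⟨x, hx⟩ : ∃ x, (boundary K G 0 (-1) (by norm_num) γ).1 x ≠ 0 := by
    by_contra! hc
    exact hγ (Subtype.ext (Finsupp.ext hc))
  obtain ⟨j, hj⟩ := Function.ne_iff.1 hx
  have hdeg : j = dim x - -1 := by
    by_contra hc
    exact hj ((boundary K G 0 (-1) (by norm_num) γ).2 x j hc)
  subst hdeg
  obtain ⟨g, hg⟩ := exists_dual_ne _ hj
  have hp : pairing 0 γ.1 (coboundary K G (-1) 0 (by norm_num) (localMap K G (-1) x g)).1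
      = (boundary K G 0 (-1) (by norm_num) γ).1 x (dim x - -1) g := by
    rw [pairing_coboundary]
    exact (pairing_single_right _ _ _ _).trans (by rw [Pi.single_eq_same])
  refine ⟨localMap K G (-1) x g, Fintype.card (G.grp (dim x - -1)), Fintype.card_pos, ?_, ?_⟩
  · rwa [hp]
  · rw [hp, dual_pow_card]

theorem exists_detect_cocycle (t : Hom₀ K G 0) (ht : t ∉ cocycles K G) :
    ∃ (ν : HomDual₀ K G 1) (m : ℕ), 0 < m ∧
      pairing 0 (boundary K G 1 0 (by norm_num) ν).1 t.1 ≠ 1 ∧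
      pairing 0 (boundary K G 1 0 (by norm_num) ν).1 t.1 ^ m = 1 := by
  obtain ⟨x, hx⟩ : ∃ x, (coboundary K G 0 1 (by norm_num) t).1 x ≠ 0 := by
    by_contra! hc
    exact ht (Subtype.ext (Finsupp.ext hc))
  obtain ⟨j, hj⟩ := Function.ne_iff.1 hx
  have hdeg : j = dim x - 1 := by
    by_contra hc
    exact hj ((coboundary K G 0 1 (by norm_num) t).2 x j hc)
  subst hdeg
  obtain ⟨α, hα⟩ := exists_dual_apply_ne _ hj
  have hp : pairing 0 (boundary K G 1 0 (by norm_num) (localDualMap K G 1 x α)).1 t.1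
      = α ((coboundary K G 0 1 (by norm_num) t).1 x (dim x - 1)) := by
    rw [pairing_boundary]
    exact (pairing_single_left _ _ _ _).trans (by rw [Pi.single_eq_same])
  refine ⟨localDualMap K G 1 x α, Fintype.card (G.grp (dim x - 1)), Fintype.card_pos, ?_, ?_⟩
  · rwa [hp]
  · rw [hp, dual_pow_card]

/-- Averaging over the conjugations by the powers of a unitary `u` with inverse `v`. -/
theorem exists_average {R : Type*} [NormedRing R] [NormedAlgebra ℂ R] (u v : R) (huv : u * v = 1)
    (hu : ‖u‖ ≤ 1) (hv : ‖v‖ ≤ 1) (m : ℕ) (hm : 0 < m) :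
    ∃ E : R →ₗ[ℂ] R, (∀ X, ‖E X‖ ≤ ‖X‖) ∧ (∀ X, u * X = X * u → E X = X) ∧
      ∀ X (c : ℂ), u * X * v = c • X → E X = ((m : ℂ)⁻¹ * ∑ k ∈ Finset.range m, c ^ k) • X := by
  let F : R →ₗ[ℂ] R := (LinearMap.mulLeft ℂ u).comp (LinearMap.mulRight ℂ v)
  have hF : ∀ X, F X = u * X * v := fun X => by simp [F, mul_assoc]
  have hm' : (m : ℂ) ≠ 0 := by exact_mod_cast hm.ne'
  have hE : ∀ X, ((m : ℂ)⁻¹ • ∑ k ∈ Finset.range m, F ^ k) X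
      = (m : ℂ)⁻¹ • ∑ k ∈ Finset.range m, (F ^ k) X := fun X => by
    simp [LinearMap.sum_apply]
  have hpow : ∀ X (c : ℂ), u * X * v = c • X → ∀ k, (F ^ k) X = c ^ k • X := fun X c h k => by
    induction k with
    | zero => simp
    | succ k ih => rw [pow_succ', Module.End.mul_apply, ih, map_smul, hF, h, smul_smul, pow_succ]
  refine ⟨(m : ℂ)⁻¹ • ∑ k ∈ Finset.range m, F ^ k, fun X => ?_, fun X h => ?_, fun X c h => ?_⟩
  · have hn : ∀ k, ‖(F ^ k) X‖ ≤ ‖X‖ := fun k => by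
      induction k with
      | zero => simp
      | succ k ih =>
        rw [pow_succ', Module.End.mul_apply, hF]
        calc ‖u * (F ^ k) X * v‖ ≤ ‖u‖ * ‖(F ^ k) X‖ * ‖v‖ :=
              (norm_mul_le _ _).trans (by gcongr; exact norm_mul_le _ _)
          _ ≤ 1 * ‖(F ^ k) X‖ * 1 := by gcongr
          _ ≤ ‖X‖ := by simpa using ih
    rw [hE, norm_smul]
    calc ‖(m : ℂ)⁻¹‖ * ‖∑ k ∈ Finset.range m, (F ^ k) X‖
        ≤ ‖(m : ℂ)⁻¹‖ * ∑ k ∈ Finset.range m, ‖X‖ := by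
          gcongr
          exact norm_sum_le_of_le _ fun k _ => hn k
      _ = ‖X‖ := by
          have : (m : ℝ) ≠ 0 := by exact_mod_cast hm.ne'
          simp [this]
  · have h1 : u * X * v = (1 : ℂ) • X := by rw [h, mul_assoc, huv, mul_one, one_smul]
    rw [hE, Finset.sum_congr rfl fun k _ => hpow X 1 h1 k]
    simp only [one_pow, one_smul, Finset.sum_const, Finset.card_range]
    rw [← Nat.cast_smul_eq_nsmul ℂ, smul_smul, inv_mul_cancel₀ hm', one_smul]
  · rw [hE, Finset.sum_congr rfl fun k _ => hpow X c h k, ← Finset.sum_smul, smul_smul]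

theorem geom_sum_eq_zero' {c : ℂ} {m : ℕ} (h1 : c ≠ 1) (hm : c ^ m = 1) :
    ∑ k ∈ Finset.range m, c ^ k = 0 := by
  rw [geom_sum_eq h1, hm, sub_self, zero_div]

theorem A_mem_core (s : Hom₀ K G (-1)) : A K G s ∈ coreAlgebra K G :=
  StarSubalgebra.le_topologicalClosure _ (StarAlgebra.subset_adjoin ℂ _ (Or.inl ⟨s, rfl⟩))

theorem B_mem_core (ν : HomDual₀ K G 1) : B K G ν ∈ coreAlgebra K G :=
  StarSubalgebra.le_topologicalClosure _ (StarAlgebra.subset_adjoin ℂ _ (Or.inr ⟨ν, rfl⟩))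

theorem norm_A_le (s : Hom₀ K G (-1)) : ‖A K G s‖ ≤ 1 := by
  rw [← QuasiLocal.norm_val]
  exact norm_shiftOp_le _

theorem norm_B_le (ν : HomDual₀ K G 1) : ‖B K G ν‖ ≤ 1 := by
  rw [← QuasiLocal.norm_val]
  exact norm_clockOp_le _

theorem exists_killing {R ι : Type*} [NormedRing R] [NormedAlgebra ℂ R] (u v : R) (huv : u * v = 1)
    (hu : ‖u‖ ≤ 1) (hv : ‖v‖ ≤ 1) (m : ℕ) (hm : 0 < m) (mon : ι → R) (c : ι → ℂ)
    (hc : ∀ k, u * mon k * v = c k • mon k) (i : ι) (h1 : c i ≠ 1) (h2 : c i ^ m = 1) :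
    ∃ (E : R →ₗ[ℂ] R) (e : ι → ℂ), (∀ X, ‖E X‖ ≤ ‖X‖) ∧ (∀ X, u * X = X * u → E X = X) ∧
      (∀ k, E (mon k) = e k • mon k) ∧ e i = 0 := by
  obtain ⟨E, hE1, hE2, hE3⟩ := exists_average u v huv hu hv m hm
  exact ⟨E, fun k => (m : ℂ)⁻¹ * ∑ l ∈ Finset.range m, c k ^ l, hE1, hE2,
    fun k => hE3 _ _ (hc k), mul_eq_zero_of_right _ (geom_sum_eq_zero' h1 h2)⟩

/-- For a monomial that is not built from a cocycle and a cycle there is an average that kills it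
and fixes the fixing algebra. -/
theorem exists_killing_average (i : Hom₀ K G 0 × HomDual₀ K G 0)
    (hi : ¬ (i.1 ∈ cocycles K G ∧ i.2 ∈ cycles K G)) :
    ∃ (E : QuasiLocal K G →ₗ[ℂ] QuasiLocal K G) (e : Hom₀ K G 0 × HomDual₀ K G 0 → ℂ),
      (∀ X, ‖E X‖ ≤ ‖X‖) ∧ (∀ X ∈ fixingAlgebra K G, E X = X) ∧
      (∀ k, E (monomial k) = e k • monomial k) ∧ e i = 0 := by
  by_cases hγ : i.2 ∈ cycles K G
  · have ht : i.1 ∉ cocycles K G := fun h => hi ⟨h, hγ⟩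
    obtain ⟨ν, m, hm, h1, h2⟩ := exists_detect_cocycle i.1 ht
    have hinv : B K G ν * B K G (-ν) = 1 := by
      rw [B, B, Q_mul, map_neg, add_neg_cancel, Q_zero]
    obtain ⟨E, e, hE1, hE2, hE3, hE4⟩ := exists_killing (B K G ν) (B K G (-ν)) hinv
      (norm_B_le _) (norm_B_le _) m hm monomial
      (fun k => pairing 0 (boundary K G 1 0 (by norm_num) ν).1 k.1.1)
      (fun k => by rw [B_mul_monomial, smul_mul_assoc, mul_assoc, hinv, mul_one]) i h1 h2
    exact ⟨E, e, hE1, fun X hX => hE2 X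
      ((StarSubalgebra.mem_centralizer_iff ℂ).1 hX _ (B_mem_core ν)).1, hE3, hE4⟩
  · obtain ⟨s, m, hm, h1, h2⟩ := exists_detect_cycle i.2 hγ
    have hinv : A K G (-s) * A K G s = 1 := by
      rw [A, A, P_mul, map_neg, neg_add_cancel, P_zero]
    obtain ⟨E, e, hE1, hE2, hE3, hE4⟩ := exists_killing (A K G (-s)) (A K G s) hinv
      (norm_A_le _) (norm_A_le _) m hm monomial
      (fun k => pairing 0 k.2.1 (coboundary K G (-1) 0 (by norm_num) s).1)
      (fun k => by rw [mul_assoc, A_mul_monomial, mul_smul_comm, ← mul_assoc, hinv, one_mul])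
      i h1 h2
    exact ⟨E, e, hE1, fun X hX => hE2 X
      ((StarSubalgebra.mem_centralizer_iff ℂ).1 hX _ (A_mem_core (-s))).1, hE3, hE4⟩

theorem exists_reduced (n : ℕ) : ∀ (F : Finset (Hom₀ K G 0 × HomDual₀ K G 0))
    (c : Hom₀ K G 0 × HomDual₀ K G 0 → ℂ), F.card = n →
    ∃ (F' : Finset (Hom₀ K G 0 × HomDual₀ K G 0)) (c' : Hom₀ K G 0 × HomDual₀ K G 0 → ℂ),
      (∀ i ∈ F', i.1 ∈ cocycles K G ∧ i.2 ∈ cycles K G) ∧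
      ∀ X ∈ fixingAlgebra K G,
        ‖X - ∑ i ∈ F', c' i • monomial i‖ ≤ ‖X - ∑ i ∈ F, c i • monomial i‖ := by
  classical
  induction n with
  | zero =>
    intro F c hF
    rw [Finset.card_eq_zero] at hF
    subst hF
    exact ⟨∅, c, by simp, fun X _ => le_rfl⟩
  | succ n ih =>
    intro F c hF
    by_cases hgood : ∀ i ∈ F, i.1 ∈ cocycles K G ∧ i.2 ∈ cycles K G
    · exact ⟨F, c, hgood, fun X _ => le_rfl⟩
    · push Not at hgood
      obtain ⟨i, hiF, hi⟩ := hgood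
      obtain ⟨E, e, hE1, hE2, hE3, hE4⟩ := exists_killing_average i fun h => hi h.1 h.2
      obtain ⟨F', c', h1, h2⟩ := ih (F.erase i) (fun k => c k * e k)
        (by rw [Finset.card_erase_of_mem hiF, hF]; rfl)
      refine ⟨F', c', h1, fun X hX => (h2 X hX).trans ?_⟩
      have h3 : ∑ k ∈ F.erase i, (c k * e k) • monomial k = E (∑ k ∈ F, c k • monomial k) := by
        rw [map_sum, ← Finset.add_sum_erase _ _ hiF]
        simp only [map_smul, hE3, hE4, zero_smul, smul_zero, zero_add, smul_smul]
      rw [h3]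
      calc ‖X - E (∑ k ∈ F, c k • monomial k)‖ = ‖E (X - ∑ k ∈ F, c k • monomial k)‖ := by
            rw [map_sub, hE2 X hX]
        _ ≤ _ := hE1 _

theorem star_A (s : Hom₀ K G (-1)) : star (A K G s) = A K G (-s) := by
  rw [A, star_P, A, map_neg]

theorem star_B (ν : HomDual₀ K G 1) : star (B K G ν) = B K G (-ν) := by
  rw [B, star_Q, B, map_neg]

/-- `P_t Q_γ` lies in the fixing algebra if `t` is a cocycle and `γ` is a cycle. -/
theorem monomial_mem_fixingAlgebra (i : Hom₀ K G 0 × HomDual₀ K G 0)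
    (h1 : i.1 ∈ cocycles K G) (h2 : i.2 ∈ cycles K G) : monomial i ∈ fixingAlgebra K G := by
  have hA : ∀ s, A K G s * monomial i = monomial i * A K G s := fun s => by
    rw [A_mul_monomial, pairing_coboundary_of_mem _ h2, one_smul]
  have hB : ∀ ν, B K G ν * monomial i = monomial i * B K G ν := fun ν => by
    rw [B_mul_monomial, pairing_boundary_of_mem _ _ h1, one_smul]
  have hle : coreAlgebra K G ≤ StarSubalgebra.centralizer ℂ {monomial i} := by
    refine StarSubalgebra.topologicalClosure_minimal (StarAlgebra.adjoin_le ?_)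
      (Set.isClosed_centralizer _)
    rintro _ (⟨s, rfl⟩ | ⟨ν, rfl⟩)
    · refine (StarSubalgebra.mem_centralizer_iff ℂ).2 ?_
      rintro _ rfl
      refine ⟨(hA s).symm, ?_⟩
      have := congrArg star (hA (-s))
      rwa [star_mul, star_mul, star_A, neg_neg] at this
    · refine (StarSubalgebra.mem_centralizer_iff ℂ).2 ?_
      rintro _ rfl
      refine ⟨(hB ν).symm, ?_⟩
      have := congrArg star (hB (-ν))
      rwa [star_mul, star_mul, star_B, neg_neg] at this
  refine (StarSubalgebra.mem_centralizer_iff ℂ).2 fun X hX => ⟨?_, ?_⟩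
  · exact (((StarSubalgebra.mem_centralizer_iff ℂ).1 (hle hX)) _ rfl).1.symm
  · exact (((StarSubalgebra.mem_centralizer_iff ℂ).1
      (hle (star_mem hX))) _ rfl).1.symm

/-- The monomials contained in the fixing algebra. -/
def units : Set (fixingAlgebra K G) :=
  {d | ∃ t ∈ cocycles K G, ∃ γ ∈ cycles K G, (d : QuasiLocal K G) = P K G t * Q K G γ}

theorem dense_span_units (X : fixingAlgebra K G) :
    X ∈ (Submodule.span ℂ (units (K := K) (G := G))).topologicalClosure := by
  refine Metric.mem_closure_iff.2 fun ε hε => ?_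
  obtain ⟨R, hR, hd⟩ := exists_approx X.1 hε
  obtain ⟨c, rfl⟩ := Finsupp.mem_span_range_iff_exists_finsupp.1 hR
  obtain ⟨F', c', h1, h2⟩ := exists_reduced _ c.support c rfl
  have hmem : ∀ i : F', monomial i.1 ∈ fixingAlgebra K G := fun i =>
    monomial_mem_fixingAlgebra _ (h1 _ i.2).1 (h1 _ i.2).2
  refine ⟨∑ i : F', c' i.1 • ⟨monomial i.1, hmem i⟩, Submodule.sum_mem _ fun i _ =>
    Submodule.smul_mem _ _ (Submodule.subset_span
      ⟨i.1.1, (h1 _ i.2).1, i.1.2, (h1 _ i.2).2, rfl⟩), ?_⟩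
  rw [dist_eq_norm]
  refine lt_of_le_of_lt ?_ hd
  have h3 := h2 X.1 X.2
  rw [← Finset.sum_coe_sort F'] at h3
  have h4 : (↑(X - ∑ i : F', c' i.1 • (⟨monomial i.1, hmem i⟩ : fixingAlgebra K G)) : QuasiLocal K G)
      = X.1 - ∑ i : F', c' i.1 • monomial i.1 := by
    simp
  calc ‖X - ∑ i : F', c' i.1 • (⟨monomial i.1, hmem i⟩ : fixingAlgebra K G)‖
      = ‖X.1 - ∑ i : F', c' i.1 • monomial i.1‖ := by rw [← h4]; rfl
    _ ≤ _ := h3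

/-! #### The redundancy space is a self-adjoint two-sided ideal -/

theorem units_mul_redundancies {w d : fixingAlgebra K G} (hw : w ∈ units)
    (hd : d ∈ redundancies K G) : w * d ∈ Submodule.span ℂ (redundancies K G) := by
  obtain ⟨r, hr, σ, hσ, hw⟩ := hw
  obtain ⟨t, ht, t', ht', γ, hγ, γ', hγ', htt, hγγ, hd⟩ := hd
  have hpair : pairing 0 σ.1 t.1 = pairing 0 σ.1 t'.1 := by
    obtain ⟨s, hs⟩ := htt
    have : t.1 = (t - t').1 + t'.1 := by simp
    rw [this, pairing_add_right, ← hs, pairing_coboundary_of_mem σ hσ, one_mul]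
  have hm1 := monomial_mem_fixingAlgebra (r + t, σ + γ) (add_mem hr ht) (add_mem hσ hγ)
  have hm2 := monomial_mem_fixingAlgebra (r + t', σ + γ') (add_mem hr ht') (add_mem hσ hγ')
  have : w * d = pairing 0 σ.1 t.1 •
      ((⟨monomial (r + t, σ + γ), hm1⟩ : fixingAlgebra K G) - ⟨monomial (r + t', σ + γ'), hm2⟩) := by
    apply Subtype.ext
    change w.1 * d.1 = pairing 0 σ.1 t.1 • (monomial (r + t, σ + γ) - monomial (r + t', σ + γ'))
    have e1 := monomial_mul (r, σ) (t, γ)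
    have e2 := monomial_mul (r, σ) (t', γ')
    rw [hw, hd, mul_sub]
    change monomial (r, σ) * monomial (t, γ) - monomial (r, σ) * monomial (t', γ') = _
    rw [e1, e2, smul_sub]
    change _ - pairing 0 σ.1 t'.1 • _ = _
    rw [← hpair]
    rfl
  rw [this]
  refine Submodule.smul_mem _ _ (Submodule.subset_span ⟨r + t, add_mem hr ht, r + t',
    add_mem hr ht', σ + γ, add_mem hσ hγ, σ + γ', add_mem hσ hγ', ?_, ?_, rfl⟩)
  · rwa [add_sub_add_left_eq_sub]
  · rwa [add_sub_add_left_eq_sub]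

theorem star_redundancies {d : fixingAlgebra K G} (hd : d ∈ redundancies K G) :
    star d ∈ Submodule.span ℂ (redundancies K G) := by
  obtain ⟨t, ht, t', ht', γ, hγ, γ', hγ', htt, hγγ, hd⟩ := hd
  have hpair : pairing 0 γ.1 t.1 = pairing 0 γ'.1 t'.1 := by
    obtain ⟨s, hs⟩ := id htt
    obtain ⟨ν, hν⟩ := id hγγ
    have e1 : t.1 = (t - t').1 + t'.1 := by simp
    have e2 : γ.1 = (γ - γ').1 + γ'.1 := by simp
    rw [e1, pairing_add_right, ← hs, pairing_coboundary_of_mem γ hγ, one_mul, e2,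
      pairing_add_left, ← hν, pairing_boundary_of_mem ν t' ht', one_mul]
  have hm1 := monomial_mem_fixingAlgebra (-t, -γ) (neg_mem ht) (neg_mem hγ)
  have hm2 := monomial_mem_fixingAlgebra (-t', -γ') (neg_mem ht') (neg_mem hγ')
  have : star d = pairing 0 γ.1 t.1 •
      ((⟨monomial (-t, -γ), hm1⟩ : fixingAlgebra K G) - ⟨monomial (-t', -γ'), hm2⟩) := by
    apply Subtype.ext
    change star d.1 = pairing 0 γ.1 t.1 • (monomial (-t, -γ) - monomial (-t', -γ'))
    have e1 := star_monomial (t, γ)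
    have e2 := star_monomial (t', γ')
    rw [hd, star_sub]
    change star (monomial (t, γ)) - star (monomial (t', γ')) = _
    rw [e1, e2, smul_sub]
    change _ - pairing 0 γ'.1 t'.1 • _ = _
    rw [← hpair]
    rfl
  rw [this]
  refine Submodule.smul_mem _ _ (Submodule.subset_span ⟨-t, neg_mem ht, -t', neg_mem ht', -γ,
    neg_mem hγ, -γ', neg_mem hγ', ?_, ?_, rfl⟩)
  · rw [neg_sub_neg, ← neg_sub]; exact neg_mem htt
  · rw [neg_sub_neg, ← neg_sub]; exact neg_mem hγγ

theorem star_mem_redundancySpace {d : fixingAlgebra K G} (hd : d ∈ redundancySpace K G) :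
    star d ∈ redundancySpace K G := by
  exact map_mem_closure continuous_star hd fun _ hx =>
    star_mem_span (fun _ h => star_redundancies h) hx

theorem mul_mem_redundancySpace (X : fixingAlgebra K G) {d : fixingAlgebra K G}
    (hd : d ∈ redundancySpace K G) : X * d ∈ redundancySpace K G := by
  exact map_mem_closure₂ continuous_mul (dense_span_units X) hd fun _ hw _ he =>
    mul_mem_span (fun _ h _ h' => units_mul_redundancies h h') hw he

theorem mem_mul_redundancySpace (X : fixingAlgebra K G) {d : fixingAlgebra K G}
    (hd : d ∈ redundancySpace K G) : d * X ∈ redundancySpace K G := by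
  have := star_mem_redundancySpace (mul_mem_redundancySpace (star X) (star_mem_redundancySpace hd))
  rwa [star_mul, star_star, star_star] at this

end Ideal

/-- The redundancy space `𝔍` as an ideal of `𝔎'`. -/
def redundancyIdeal : Ideal (fixingAlgebra K G) where
  carrier := redundancySpace K G
  add_mem' := fun ha hb => add_mem ha hb
  zero_mem' := zero_mem _
  smul_mem' := fun X _ hd => mul_mem_redundancySpace X hd

instance : (redundancyIdeal K G).IsTwoSided :=
  ⟨fun {_} b hd => mem_mul_redundancySpace b hd⟩

/-- The algebra of logical operators `𝔄_log = 𝔎' / 𝔍`, with the quotient topology. -/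
abbrev LogicalAlgebra : Type (max u w) := fixingAlgebra K G ⧸ redundancyIdeal K G

/-- The involution `[X]* = [X*]` on `𝔄_log`. -/
instance : StarRing (LogicalAlgebra K G) where
  star := Quotient.map' star fun a b h => by
    rw [Submodule.quotientRel_def] at h ⊢
    have := star_mem_redundancySpace h
    rwa [star_sub] at this
  star_involutive := by
    rintro ⟨a⟩
    exact congrArg (Ideal.Quotient.mk (redundancyIdeal K G)) (star_star a)
  star_mul := by
    rintro ⟨a⟩ ⟨b⟩
    exact congrArg (Ideal.Quotient.mk (redundancyIdeal K G)) (star_mul a b)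
  star_add := by
    rintro ⟨a⟩ ⟨b⟩
    exact congrArg (Ideal.Quotient.mk (redundancyIdeal K G)) (star_add a b)

/-- The class `[X] ∈ 𝔄_log` of an element `X` of the fixing algebra. -/
def logicalClass : fixingAlgebra K G →+* LogicalAlgebra K G :=
  Ideal.Quotient.mk (redundancyIdeal K G)

end

end HAQDM

/-! A state ω is a frustration-free ground state exactly when ω(A_t) = ω(B_γ) = 1 for all t and γ
(`mem_ffGroundStates_iff`). Indeed, a mean of unitaries can have value 1 only if every one of them
does. Conversely, a projection p with ω(p) = 1 satisfies ω(X(1 - p)) = 0 for every X, and this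
yields the ground state inequality term by term.

The basic tool is Cauchy–Schwarz: if ω(u) = 1 for a unitary u, then 1 - u is a null vector, so ω(au)
= ω(a) = ω(ua) (`apply_mul_unitary`, `apply_unitary_mul`). It has two consequences for a
frustration-free ω. A monomial P_t Q_γ that commutes with some A or B only up to a phase c ≠ 1 has
ω-value zero. Since the monomials span a dense subspace, ω is therefore determined by its
restriction to the fixing algebra 𝔎'. Moreover, if t, t' are cohomologous and γ, γ' homologous, then
P_t Q_γ = A_s P_{t'} Q_{γ'} B_ν, so ω kills 𝔍 and descends to 𝔄_log.

For the converse, a state of 𝔄_log is pulled back to 𝔎' and extended to 𝔄 by Hahn–Banach; a unital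
contractive extension is again a state. Because ∂∂ = 0, all A_t and B_γ lie in 𝔎', and they are
congruent to 1 modulo 𝔍. Any such extension thus has value 1 on them and is frustration-free
(`exists_ffGroundState`).

Restriction is therefore a continuous bijection from a compact space onto a Hausdorff one, that is,
a homeomorphism. It is affine, and the frustration-free ground states form a face of the state
space, because 1 is an extreme point of the unit disc. Extreme points hence correspond to extreme
points. -/

namespace HAQDM

universe u w

noncomputable section

/-! ### Positive functionals and states on a C*-algebra -/

section States

variable {R : Type*} [CStarAlgebra R]

/-- A positive functional on a C*-algebra, as a positive linear map for the spectral order. -/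
def toPositive [PartialOrder R] [StarOrderedRing R] (f : R →ₗ[ℂ] ℂ)
    (hf : ∀ a, 0 ≤ f (star a * a)) : R →ₚ[ℂ] ℂ :=
  PositiveLinearMap.mk₀ f fun a ha => by
    obtain ⟨b, rfl⟩ := CStarAlgebra.nonneg_iff_eq_star_mul_self.1 ha
    exact hf b

/-- This is the Cauchy–Schwarz inequality of the GNS semi-inner product ⟨a, b⟩ = f(a* b). -/
theorem norm_apply_star_mul_sq_le (f : R →ₗ[ℂ] ℂ) (hf : ∀ a, 0 ≤ f (star a * a)) (a b : R) :
    ‖f (star a * b)‖ ^ 2 ≤ (f (star a * a)).re * (f (star b * b)).re := by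
  let _ := CStarAlgebra.spectralOrder R
  have _ := CStarAlgebra.spectralOrderedRing R
  let F := toPositive f hf
  have h := norm_inner_le_norm (𝕜 := ℂ) (F.toPreGNS a) (F.toPreGNS b)
  have h' := pow_le_pow_left₀ (norm_nonneg _) h 2
  have hn : ∀ c, ‖F.toPreGNS c‖ ^ 2 = (f (star c * c)).re := fun c => by
    have := F.preGNS_norm_sq (F.toPreGNS c)
    have := congrArg Complex.re this
    rw [← Complex.ofReal_pow, Complex.ofReal_re] at this
    exact this
  rw [mul_pow, hn, hn] at h'
  exact h'

theorem apply_star (f : R →ₗ[ℂ] ℂ) (hf : ∀ a, 0 ≤ f (star a * a)) (a : R) :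
    f (star a) = star (f a) := by
  let _ := CStarAlgebra.spectralOrder R
  have _ := CStarAlgebra.spectralOrderedRing R
  let F := toPositive f hf
  exact map_star F a

/-- Cauchy–Schwarz against 1 gives |f(a)|² ≤ f(a* a) ≤ ‖a* a‖ = ‖a‖². Continuity is a conclusion
here, so the bound also applies to functionals that are only known to be linear and positive. -/
theorem norm_apply_le (f : R →ₗ[ℂ] ℂ) (hf : ∀ a, 0 ≤ f (star a * a)) (h1 : f 1 = 1) (a : R) :
    ‖f a‖ ≤ ‖a‖ := by
  let _ := CStarAlgebra.spectralOrder R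
  have _ := CStarAlgebra.spectralOrderedRing R
  let F := toPositive f hf
  have h := norm_apply_star_mul_sq_le f hf 1 a
  have h2 : ‖f (star a * a)‖ ≤ ‖f 1‖ * ‖star a * a‖ :=
    F.norm_apply_le_of_nonneg _ (star_mul_self_nonneg a)
  rw [h1, norm_one, one_mul, CStarRing.norm_star_mul_self] at h2
  rw [star_one, one_mul, one_mul, h1, Complex.one_re, one_mul] at h
  exact abs_le_of_sq_le_sq' (by nlinarith [Complex.re_le_norm (f (star a * a))])
    (norm_nonneg a) |>.2

/-- A unital contractive functional is positive. -/
theorem nonneg_of_norm_apply_le (f : R →ₗ[ℂ] ℂ) (h1 : f 1 = 1) (hn : ∀ a, ‖f a‖ ≤ ‖a‖) (a : R) :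
    0 ≤ f (star a * a) := by
  let _ := CStarAlgebra.spectralOrder R
  have _ := CStarAlgebra.spectralOrderedRing R
  -- The value f 1 = 1 excludes the zero ring, so that ‖1‖ = 1.
  have hone : Nontrivial R := ⟨1, 0, fun h => by rw [h, map_zero] at h1; exact zero_ne_one h1⟩
  set b := star a * a with hb
  have hb0 : 0 ≤ b := star_mul_self_nonneg a
  have hbs : star b = b := (IsSelfAdjoint.of_nonneg hb0).star_eq
  -- Since 0 ≤ ‖b‖ - b ≤ ‖b‖, contractivity gives |‖b‖ - f(b)| ≤ ‖b‖, which is impossible if f(b)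
  -- has negative real part.
  have hre : 0 ≤ (f b).re := by
    have h2 : ‖algebraMap ℝ R ‖b‖ - b‖ ≤ ‖b‖ := by
      have hs : (0 : R) ≤ algebraMap ℝ R ‖b‖ - b :=
        sub_nonneg.2 (IsSelfAdjoint.le_algebraMap_norm_self (.of_nonneg hb0))
      refine (CStarAlgebra.norm_le_norm_of_nonneg_of_le hs
        (sub_le_self _ hb0)).trans ?_
      rw [norm_algebraMap', norm_norm]
    have h3 := (hn _).trans h2
    have h4 : f (algebraMap ℝ R ‖b‖ - b) = ‖b‖ - f b := by
      rw [map_sub, Algebra.algebraMap_eq_smul_one, ← Complex.coe_smul, map_smul, h1]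
      simp
    rw [h4] at h3
    have h5 := (Complex.re_le_norm _).trans h3
    simp at h5
    linarith
  have him : (f b).im = 0 := by
    -- Contractivity is tested at c = b + it: by the C*-identity ‖c‖² = ‖b² + t²‖ ≤ ‖b‖² + t², while
    -- the imaginary part of f(c) is that of f(b) plus t.
    have key : ∀ t : ℝ, ((f b).im + t) ^ 2 ≤ ‖b‖ ^ 2 + t ^ 2 := fun t => by
      set c : R := b + (Complex.I * t) • (1 : R) with hc
      have e1 : f c = f b + Complex.I * t := by rw [hc, map_add, map_smul, h1]; simp
      have e2 : star c * c = b * b + ((t ^ 2 : ℝ) : ℂ) • (1 : R) := by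
        have : star c = b + (-(Complex.I * t)) • (1 : R) := by
          rw [hc, star_add, star_smul, star_one, hbs]; simp
        rw [this, hc, add_mul, mul_add, mul_add, smul_mul_smul_comm, smul_mul_assoc,
          mul_smul_comm, one_mul, one_mul, mul_one, neg_smul]
        have : -(Complex.I * t) * (Complex.I * t) = ((t ^ 2 : ℝ) : ℂ) := by
          have := Complex.I_mul_I
          push_cast
          linear_combination (-(t:ℂ)^2) * this
        rw [this]
        abel
      have e3 : ‖c‖ ^ 2 ≤ ‖b‖ ^ 2 + t ^ 2 := by
        rw [sq ‖c‖, ← CStarRing.norm_star_mul_self, e2]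
        refine (norm_add_le _ _).trans (add_le_add ((norm_mul_le _ _).trans (sq _).ge) ?_)
        rw [norm_smul, norm_one, mul_one, Complex.norm_real, Real.norm_of_nonneg (sq_nonneg t)]
      have e4 : ((f c).im) ^ 2 ≤ ‖f c‖ ^ 2 :=
        sq_le_sq.2 (by rw [abs_norm]; exact Complex.abs_im_le_norm _)
      have e5 := pow_le_pow_left₀ (norm_nonneg _) (hn c) 2
      have e6 : (f c).im = (f b).im + t := by rw [e1]; simp
      rw [e6] at e4
      linarith
    by_contra hne
    -- After cancelling t², the bound reads y² + 2yt ≤ ‖b‖² with y the imaginary part of f(b); this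
    -- t makes 2yt equal to ‖b‖² + 1.
    have := key ((‖b‖ ^ 2 + 1) / (2 * (f b).im))
    have e : 2 * (f b).im * ((‖b‖ ^ 2 + 1) / (2 * (f b).im)) = ‖b‖ ^ 2 + 1 := by
      field_simp
    nlinarith [sq_nonneg (f b).im]
  exact Complex.nonneg_iff.2 ⟨hre, him.symm⟩

/-- Cauchy–Schwarz: a null vector of the semi-inner product is orthogonal to everything. -/
theorem apply_mul_eq_zero (f : R →ₗ[ℂ] ℂ) (hf : ∀ a, 0 ≤ f (star a * a)) {d : R}
    (hd : f (star d * d) = 0) (a : R) : f (a * d) = 0 := by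
  have := norm_apply_star_mul_sq_le f hf (star a) d
  rw [hd, Complex.zero_re, mul_zero, star_star] at this
  exact norm_eq_zero.1 (pow_eq_zero_iff two_ne_zero |>.1 (le_antisymm this (sq_nonneg _)))

/-- The value of a state at `|1 - u|²`, for a unitary `u`. -/
theorem apply_star_one_sub_mul (f : R →ₗ[ℂ] ℂ) (hf : ∀ a, 0 ≤ f (star a * a)) (h1 : f 1 = 1)
    {u : R} (hu : star u * u = 1) : f (star (1 - u) * (1 - u)) = ((2 - 2 * (f u).re : ℝ) : ℂ) := by
  have : star (1 - u) * (1 - u) = 1 - u - star u + star u * u := by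
    rw [star_sub, star_one]; noncomm_ring
  rw [this, hu, map_add, map_sub, map_sub, h1, apply_star f hf]
  apply Complex.ext <;> simp
  ring

theorem re_apply_le_one (f : R →ₗ[ℂ] ℂ) (hf : ∀ a, 0 ≤ f (star a * a)) (h1 : f 1 = 1)
    {u : R} (hu : star u * u = 1) : (f u).re ≤ 1 := by
  have := hf (1 - u)
  rw [apply_star_one_sub_mul f hf h1 hu, Complex.zero_le_real] at this
  linarith

/-- By `apply_star_one_sub_mul`, the real part of f(u) alone decides whether 1 - u is a null vector.
If it is, u is absorbed on the right of any element. -/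
theorem apply_mul_unitary (f : R →ₗ[ℂ] ℂ) (hf : ∀ a, 0 ≤ f (star a * a)) (h1 : f 1 = 1)
    {u : R} (hu : star u * u = 1) (hfu : (f u).re = 1) (a : R) : f (a * u) = f a := by
  have h := apply_star_one_sub_mul f hf h1 hu
  rw [hfu] at h
  have h := apply_mul_eq_zero f hf (d := 1 - u) (by rw [h]; norm_num) a
  rw [mul_sub, mul_one, map_sub, sub_eq_zero] at h
  exact h.symm

theorem apply_unitary (f : R →ₗ[ℂ] ℂ) (hf : ∀ a, 0 ≤ f (star a * a)) (h1 : f 1 = 1)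
    {u : R} (hu : star u * u = 1) (hfu : (f u).re = 1) : f u = 1 := by
  rw [← one_mul u, apply_mul_unitary f hf h1 hu hfu, h1]

/-- Absorption on the left is the adjoint of absorption of u* on the right. -/
theorem apply_unitary_mul (f : R →ₗ[ℂ] ℂ) (hf : ∀ a, 0 ≤ f (star a * a)) (h1 : f 1 = 1)
    {u : R} (hu : u * star u = 1) (hfu : (f u).re = 1) (a : R) : f (u * a) = f a := by
  have h := apply_mul_unitary f hf h1 (u := star u) (by rwa [star_star])
    (by rw [apply_star f hf]; simpa using hfu) (star a)
  rw [← star_mul, apply_star f hf, apply_star f hf] at h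
  exact star_injective h

/-- If a state has mean one over a finite family of unitaries, it has value one at each of them. -/
theorem apply_eq_one_of_mean (f : R →ₗ[ℂ] ℂ) (hf : ∀ a, 0 ≤ f (star a * a)) (h1 : f 1 = 1)
    {ι : Type*} [Fintype ι] (u : ι → R) (hu : ∀ i, star (u i) * u i = 1)
    (hmean : ∑ i, f (u i) = Fintype.card ι) (i : ι) : f (u i) = 1 := by
  refine apply_unitary f hf h1 (hu i) ?_
  -- The defects 1 - re f(u i) are nonnegative and add up to zero, so each of them vanishes.
  have h2 : ∑ i, (1 - (f (u i)).re) = 0 := by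
    have := congrArg Complex.re hmean
    rw [Complex.re_sum, Complex.natCast_re] at this
    rw [Finset.sum_sub_distrib, this]
    simp
  have h3 := (Finset.sum_eq_zero_iff_of_nonneg fun i _ =>
    sub_nonneg.2 (re_apply_le_one f hf h1 (hu i))).1 h2 i (Finset.mem_univ i)
  linarith

/-- Banach–Alaoglu: the states form a weak-* closed subset of the dual unit ball. -/
theorem isCompact_stateSpace : IsCompact (stateSpace R) := by
  refine IsCompact.of_isClosed_subset (WeakDual.isCompact_closedBall 0 1) ?_ ?_
  · have : stateSpace R = (⋂ a : R, {ω | 0 ≤ ω (star a * a)}) ∩ {ω | ω 1 = 1} := by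
      ext ω; simp [stateSpace]
    rw [this]
    exact (isClosed_iInter fun a => isClosed_le continuous_const (WeakDual.eval_continuous _)).inter
      (isClosed_eq (WeakDual.eval_continuous _) continuous_const)
  · rintro ω ⟨h0, h1⟩
    rw [Set.mem_preimage, mem_closedBall_zero_iff]
    exact ContinuousLinearMap.opNorm_le_bound _ zero_le_one fun a => by
      rw [one_mul]
      exact norm_apply_le (ω : R →L[ℂ] ℂ).toLinearMap h0 h1 a

/-- States extend from closed unital *-subalgebras. -/
theorem exists_extension_state (S : StarSubalgebra ℂ R) (hS : IsClosed (S : Set R))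
    (f : S →ₗ[ℂ] ℂ) (hf : ∀ a, 0 ≤ f (star a * a)) (h1 : f 1 = 1) :
    ∃ ω ∈ stateSpace R, ∀ a : S, ω (a : R) = f a := by
  let _ : CStarAlgebra S := StarSubalgebra.cstarAlgebra S (h_closed := hS)
  have hn := norm_apply_le f hf h1
  let F : S →L[ℂ] ℂ := f.mkContinuous 1 fun a => by rw [one_mul]; exact hn a
  -- Hahn–Banach keeps the norm at most 1 and the value 1 at the unit; `nonneg_of_norm_apply_le`
  -- then recovers the positivity that an arbitrary linear extension would lose.
  obtain ⟨g, hg, hgn⟩ := exists_extension_norm_eq (𝕜 := ℂ) S.toSubalgebra.toSubmodule F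
  have hg1 : g 1 = 1 := (hg 1).trans h1
  have hF : ‖F‖ ≤ 1 := f.mkContinuous_norm_le zero_le_one _
  refine ⟨StrongDual.toWeakDual g, ⟨nonneg_of_norm_apply_le g.toLinearMap hg1 fun a => ?_, hg1⟩,
    fun a => hg a⟩
  have := g.le_of_opNorm_le (hgn.le.trans hF) a
  rwa [one_mul] at this

end States

variable {V : Type u} [LinearOrder V] {N L : ℕ}
variable {K : GeometricData V N L} {G : AlgebraicData.{w} N}

/-! ### Frustration-free ground states as the states with value one on all `A` and `B` -/

section FrustrationFree

theorem A_add (s s' : Hom₀ K G (-1)) : A K G (s + s') = A K G s * A K G s' := by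
  rw [A, A, A, P_mul, map_add]

theorem B_add (ν ν' : HomDual₀ K G 1) : B K G (ν + ν') = B K G ν * B K G ν' := by
  rw [B, B, B, Q_mul, map_add]

theorem A_zero : A K G 0 = 1 := by rw [A, map_zero, P_zero]

theorem B_zero : B K G 0 = 1 := by rw [B, map_zero, Q_zero]

theorem star_A_mul_A (s : Hom₀ K G (-1)) : star (A K G s) * A K G s = 1 := by
  rw [star_A, ← A_add, neg_add_cancel, A_zero]

theorem A_mul_star_A (s : Hom₀ K G (-1)) : A K G s * star (A K G s) = 1 := by
  rw [star_A, ← A_add, add_neg_cancel, A_zero]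

theorem star_B_mul_B (ν : HomDual₀ K G 1) : star (B K G ν) * B K G ν = 1 := by
  rw [star_B, ← B_add, neg_add_cancel, B_zero]

theorem B_mul_star_B (ν : HomDual₀ K G 1) : B K G ν * star (B K G ν) = 1 := by
  rw [star_B, ← B_add, add_neg_cancel, B_zero]

theorem localMap_add (p : ℤ) (x : K.Simplex) (g h : G.grp (dim x - p)) :
    localMap K G p x (g + h) = localMap K G p x g + localMap K G p x h :=
  Subtype.ext (by
    change Finsupp.single x _ = Finsupp.single x _ + Finsupp.single x _
    rw [← Finsupp.single_add, Pi.single_add])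

theorem localDualMap_add (p : ℤ) (x : K.Simplex) (α β : G.dual (dim x - p)) :
    localDualMap K G p x (α + β) = localDualMap K G p x α + localDualMap K G p x β :=
  Subtype.ext (by
    change Finsupp.single x _ = Finsupp.single x _ + Finsupp.single x _
    rw [← Finsupp.single_add, Pi.single_add])

/-- The star operators only involve maps concentrated at one simplex. This decomposition, through
`A_add`, carries their information to every `A s`. -/
theorem eq_sum_localMap (p : ℤ) (t : Hom₀ K G p) :
    t = ∑ x ∈ t.1.support, localMap K G p x (t.1 x (dim x - p)) := by
  refine Subtype.ext ?_
  rw [AddSubgroup.val_finsetSum]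
  conv_lhs => rw [← Finsupp.sum_single t.1]
  refine Finset.sum_congr rfl fun x _ => congrArg (Finsupp.single x) (funext fun j => ?_)
  rcases eq_or_ne j (dim x - p) with rfl | hj
  · rw [Pi.single_eq_same]
  · rw [Pi.single_eq_of_ne hj, t.2 x j hj]

theorem eq_sum_localDualMap (p : ℤ) (γ : HomDual₀ K G p) :
    γ = ∑ x ∈ γ.1.support, localDualMap K G p x (γ.1 x (dim x - p)) := by
  refine Subtype.ext ?_
  rw [AddSubgroup.val_finsetSum]
  conv_lhs => rw [← Finsupp.sum_single γ.1]
  refine Finset.sum_congr rfl fun x _ => congrArg (Finsupp.single x) (funext fun j => ?_)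
  rcases eq_or_ne j (dim x - p) with rfl | hj
  · rw [Pi.single_eq_same]
  · rw [Pi.single_eq_of_ne hj, γ.2 x j hj]

/-- Duality of finite abelian groups. `plaquetteOp` divides by the order of `G.grp` but sums over
`G.dual`; equality of the two orders makes it a genuine mean. -/
theorem card_dual (j : ℤ) : Fintype.card (G.dual j) = Fintype.card (G.grp j) :=
  AddChar.card_eq

section Mean

variable {R M : Type*} [CStarAlgebra R] [AddCommGroup M] [Fintype M]

/-- The mean of a unitary representation of a finite group is idempotent. -/
theorem mean_mul_mean (U : M → R) (hU : ∀ g h, U (g + h) = U g * U h) :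
    ((Fintype.card M : ℂ)⁻¹ • ∑ g, U g) * ((Fintype.card M : ℂ)⁻¹ • ∑ g, U g)
      = (Fintype.card M : ℂ)⁻¹ • ∑ g, U g := by
  have hM : (Fintype.card M : ℂ) ≠ 0 := by exact_mod_cast Fintype.card_ne_zero
  -- Multiplication by U g only permutes the inner sum, so all summands of the outer sum coincide.
  have h : (∑ g, U g) * ∑ g, U g = (Fintype.card M : ℂ) • ∑ g, U g := by
    rw [Finset.sum_mul, Finset.sum_congr rfl (g := fun _ => ∑ g, U g)]
    · rw [Finset.sum_const, Finset.card_univ, ← Nat.cast_smul_eq_nsmul ℂ]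
    · intro g _
      rw [Finset.mul_sum, ← Equiv.sum_comp (Equiv.addLeft g) U]
      exact Finset.sum_congr rfl fun h _ => (hU g h).symm
  rw [smul_mul_smul_comm, h, smul_smul, mul_assoc, inv_mul_cancel₀ hM, mul_one]

theorem star_mean (U : M → R) (hU : ∀ g, star (U g) = U (-g)) :
    star ((Fintype.card M : ℂ)⁻¹ • ∑ g, U g) = (Fintype.card M : ℂ)⁻¹ • ∑ g, U g := by
  rw [star_smul, star_sum, ← Equiv.sum_comp (Equiv.neg M) U]
  simp [hU]

end Mean

theorem localMap_neg (p : ℤ) (x : K.Simplex) (g : G.grp (dim x - p)) :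
    localMap K G p x (-g) = -localMap K G p x g :=
  map_neg (AddMonoidHom.mk' (localMap K G p x) (localMap_add p x)) g

theorem localDualMap_neg (p : ℤ) (x : K.Simplex) (α : G.dual (dim x - p)) :
    localDualMap K G p x (-α) = -localDualMap K G p x α :=
  map_neg (AddMonoidHom.mk' (localDualMap K G p x) (localDualMap_add p x)) α

theorem isStarProjection_starOp (x : K.Simplex) : IsStarProjection (starOp K G x) where
  isIdempotentElem := mean_mul_mean (fun g => A K G (localMap K G (-1) x g)) fun g h => by
    rw [localMap_add, A_add]
  isSelfAdjoint := star_mean (fun g => A K G (localMap K G (-1) x g)) fun g => by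
    rw [localMap_neg, star_A]

theorem isStarProjection_plaquetteOp (x : K.Simplex) : IsStarProjection (plaquetteOp K G x) := by
  rw [plaquetteOp, ← card_dual]
  exact {
    isIdempotentElem := mean_mul_mean (fun α => B K G (localDualMap K G 1 x α)) fun g h => by
      rw [localDualMap_add, B_add]
    isSelfAdjoint := star_mean (fun α => B K G (localDualMap K G 1 x α)) fun g => by
      rw [localDualMap_neg, star_B] }

/-- A state is a frustration-free ground state iff it has value one at all `A_t` and `B_γ`. -/
theorem mem_ffGroundStates_iff {ω : WeakDual ℂ (QuasiLocal K G)} :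
    ω ∈ ffGroundStates K G ↔ ω ∈ stateSpace (QuasiLocal K G) ∧
      (∀ s, ω (A K G s) = 1) ∧ ∀ ν, ω (B K G ν) = 1 := by
  classical
  constructor
  · rintro ⟨⟨hω, -⟩, h⟩
    refine ⟨hω, fun s => ?_, fun ν => ?_⟩
    · have hloc : ∀ x g, ω (A K G (localMap K G (-1) x g)) = 1 := fun x =>
        apply_eq_one_of_mean (ω : QuasiLocal K G →L[ℂ] ℂ).toLinearMap hω.1 hω.2
          (fun g => A K G (localMap K G (-1) x g)) (fun g => star_A_mul_A _) (by
          have := (h x x).1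
          rw [starOp, map_smul, map_sum, smul_eq_mul, inv_mul_eq_one₀
            (by exact_mod_cast Fintype.card_ne_zero)] at this
          exact this.symm)
      -- `A s` becomes a product of local unitaries of value one, which are absorbed one at a time.
      rw [eq_sum_localMap (-1) s]
      induction s.1.support using Finset.induction_on with
      | empty => rw [Finset.sum_empty, A_zero]; exact hω.2
      | insert x F hx ih =>
        rw [Finset.sum_insert hx, A_add]
        exact (apply_unitary_mul (ω : QuasiLocal K G →L[ℂ] ℂ).toLinearMap hω.1 hω.2
          (A_mul_star_A _) (by exact congrArg Complex.re (hloc _ _)) _).trans ih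
    · have hloc : ∀ x α, ω (B K G (localDualMap K G 1 x α)) = 1 := fun x =>
        apply_eq_one_of_mean (ω : QuasiLocal K G →L[ℂ] ℂ).toLinearMap hω.1 hω.2
          (fun α => B K G (localDualMap K G 1 x α)) (fun g => star_B_mul_B _) (by
          have := (h x x).2
          rw [plaquetteOp, ← card_dual, map_smul, map_sum, smul_eq_mul, inv_mul_eq_one₀
            (by exact_mod_cast Fintype.card_ne_zero)] at this
          exact this.symm)
      rw [eq_sum_localDualMap 1 ν]
      induction ν.1.support using Finset.induction_on with
      | empty => rw [Finset.sum_empty, B_zero]; exact hω.2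
      | insert x F hx ih =>
        rw [Finset.sum_insert hx, B_add]
        exact (apply_unitary_mul (ω : QuasiLocal K G →L[ℂ] ℂ).toLinearMap hω.1 hω.2
          (B_mul_star_B _) (by exact congrArg Complex.re (hloc _ _)) _).trans ih
  · rintro ⟨hω, hA, hB⟩
    have hstar : ∀ x, ω (starOp K G x) = 1 := fun x => by
      rw [starOp, map_smul, map_sum, Finset.sum_congr rfl fun g _ => hA _]
      simp
    have hplaq : ∀ x, ω (plaquetteOp K G x) = 1 := fun x => by
      rw [plaquetteOp, ← card_dual, map_smul, map_sum, Finset.sum_congr rfl fun g _ => hB _]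
      simp
    refine ⟨⟨hω, fun T hT => ?_⟩, fun x y => ⟨hstar x, hplaq y⟩⟩
    obtain ⟨Λ, hΛ⟩ := (derivation_eventually T hT).exists
    -- Since ω(X(1 - p)) = 0 for every X, ω(T*[p, T]) equals -ω(|(1 - p)T|²). Each projection is
    -- treated separately, so their mutual commutation plays no role.
    have hproj : ∀ p : QuasiLocal K G, IsStarProjection p → ω p = 1 →
        ω (star T * (p * T - T * p)) ≤ 0 := fun p hp hp1 => by
      have h0 : ∀ X, ω (X * (1 - p)) = 0 :=
        apply_mul_eq_zero (ω : QuasiLocal K G →L[ℂ] ℂ).toLinearMap hω.1 (by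
          have := hp.one_sub
          rw [this.isSelfAdjoint.star_eq, this.isIdempotentElem.eq]
          change ω (1 - p) = 0
          rw [map_sub, hω.2, hp1, sub_self])
      have h1 := hω.1 ((1 - p) * T)
      have h2 : star ((1 - p) * T) * ((1 - p) * T) = star T * T - star T * p * T := by
        have hq := hp.one_sub
        rw [star_mul, hq.isSelfAdjoint.star_eq, mul_assoc, ← mul_assoc (1 - p) (1 - p),
          hq.isIdempotentElem.eq]
        noncomm_ring
      have h3 : star T * (p * T - T * p)
          = star T * T * (1 - p) - (star T * T - star T * p * T) := by noncomm_ring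
      rw [h3, map_sub, h0, ← h2, zero_sub]
      exact neg_nonpos.2 h1
    rw [hΛ, localHamiltonian, mul_smul_comm, map_smul, smul_eq_mul, ← mul_assoc]
    -- The factor -i cancels the i of the derivation, and the minus sign in the Hamiltonian turns
    -- the bounds of `hproj` into nonnegativity.
    have hI : -Complex.I * Complex.I = 1 := by simp
    rw [hI, one_mul]
    have hsum : ∀ (F F' : Finset K.Simplex),
        star T * (-(∑ x ∈ F, starOp K G x + ∑ x ∈ F', plaquetteOp K G x) * T
          - T * -(∑ x ∈ F, starOp K G x + ∑ x ∈ F', plaquetteOp K G x))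
        = -(∑ x ∈ F, star T * (starOp K G x * T - T * starOp K G x)
          + ∑ x ∈ F', star T * (plaquetteOp K G x * T - T * plaquetteOp K G x)) := fun F F' => by
      simp only [← Finset.mul_sum, Finset.sum_sub_distrib, ← Finset.sum_mul]
      noncomm_ring
    rw [hsum, map_neg, map_add, map_sum, map_sum]
    exact neg_nonneg.2 (add_nonpos
      (Finset.sum_nonpos fun x _ => hproj _ (isStarProjection_starOp x) (hstar x))
      (Finset.sum_nonpos fun x _ => hproj _ (isStarProjection_plaquetteOp x) (hplaq x)))

/-- If a proper convex combination of two states has value one at a unitary, so do both states. -/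
theorem apply_eq_one_of_convex {R : Type*} [CStarAlgebra R] {ω₁ ω₂ : WeakDual ℂ R}
    (h₁ : ω₁ ∈ stateSpace R) (h₂ : ω₂ ∈ stateSpace R) {a b : ℝ} (ha : 0 < a) (hb : 0 < b)
    (hab : a + b = 1) {u : R} (hu : star u * u = 1) (h : (a • ω₁ + b • ω₂) u = 1) :
    ω₁ u = 1 ∧ ω₂ u = 1 := by
  have e : (a • ω₁ + b • ω₂) u = a * ω₁ u + b * ω₂ u := rfl
  rw [e] at h
  have h' := congrArg Complex.re h
  rw [Complex.add_re, Complex.re_ofReal_mul, Complex.re_ofReal_mul, Complex.one_re] at h'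
  -- Two real numbers that are at most 1 and have a proper convex combination equal to 1 are both 1.
  have k₁ : (ω₁ u).re ≤ 1 := re_apply_le_one (ω₁ : R →L[ℂ] ℂ).toLinearMap h₁.1 h₁.2 hu
  have k₂ : (ω₂ u).re ≤ 1 := re_apply_le_one (ω₂ : R →L[ℂ] ℂ).toLinearMap h₂.1 h₂.2 hu
  exact ⟨apply_unitary (ω₁ : R →L[ℂ] ℂ).toLinearMap h₁.1 h₁.2 hu
      (show (ω₁ u).re = 1 by nlinarith),
    apply_unitary (ω₂ : R →L[ℂ] ℂ).toLinearMap h₂.1 h₂.2 hu (show (ω₂ u).re = 1 by nlinarith)⟩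

/-- The frustration-free ground states form a face of the state space. -/
theorem mem_ffGroundStates_of_convex {ω₁ ω₂ : WeakDual ℂ (QuasiLocal K G)}
    (h₁ : ω₁ ∈ stateSpace (QuasiLocal K G)) (h₂ : ω₂ ∈ stateSpace (QuasiLocal K G)) {a b : ℝ}
    (ha : 0 < a) (hb : 0 < b) (hab : a + b = 1) (h : a • ω₁ + b • ω₂ ∈ ffGroundStates K G) :
    ω₁ ∈ ffGroundStates K G ∧ ω₂ ∈ ffGroundStates K G := by
  simp only [mem_ffGroundStates_iff] at h ⊢
  have hA := fun s => apply_eq_one_of_convex h₁ h₂ ha hb hab (star_A_mul_A s) (h.2.1 s)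
  have hB := fun ν => apply_eq_one_of_convex h₁ h₂ ha hb hab (star_B_mul_B ν) (h.2.2 ν)
  exact ⟨⟨h₁, fun s => (hA s).1, fun ν => (hB ν).1⟩, ⟨h₂, fun s => (hA s).2, fun ν => (hB ν).2⟩⟩

/-- In the form given by `mem_ffGroundStates_iff`, all conditions are equations between weak-*
continuous evaluations and constants, so they cut out a closed subset of the state space. -/
theorem isCompact_ffGroundStates : IsCompact (ffGroundStates K G) := by
  refine isCompact_stateSpace.of_isClosed_subset ?_ fun ω hω => hω.1.1
  have : ffGroundStates K G = stateSpace (QuasiLocal K G) ∩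
      ((⋂ s, {ω | ω (A K G s) = 1}) ∩ ⋂ ν, {ω | ω (B K G ν) = 1}) := by
    ext ω
    simp only [mem_ffGroundStates_iff, Set.mem_inter_iff, Set.mem_iInter, Set.mem_ofPred_eq]
  rw [this]
  exact isCompact_stateSpace.isClosed.inter
    ((isClosed_iInter fun s => isClosed_eq (WeakDual.eval_continuous _) continuous_const).inter
      (isClosed_iInter fun ν => isClosed_eq (WeakDual.eval_continuous _) continuous_const))

end FrustrationFree

/-! ### The relation ∂∂ = 0: coboundaries are cocycles and boundaries are cycles -/

section BoundarySquared

/-- Only `a` is omitted, so the existential in `incidence` collapses to `· < a`. Together with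
`exists_eq_erase` this turns nonzero incidences into erasures of one vertex. -/
theorem incidence_of_eq_erase {x y : K.Simplex} {a : V} (ha : a ∈ x.1) (hy : y.1 = x.1.erase a) :
    incidence x y = (K.orient x : ℤ) * (K.orient y : ℤ) * (-1) ^ (x.1.filter (· < a)).card := by
  have h1 : y.1 ⊆ x.1 ∧ x.1.card = y.1.card + 1 :=
    ⟨hy ▸ Finset.erase_subset _ _, by rw [hy, Finset.card_erase_add_one ha]⟩
  have h2 : (x.1.filter fun c => ∃ v ∈ x.1 \ y.1, c < v) = x.1.filter (· < a) := by
    refine Finset.filter_congr fun c _ => ?_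
    rw [hy]
    refine ⟨?_, fun h => ⟨a, by simp [ha], h⟩⟩
    rintro ⟨v, hv, hc⟩
    have : v = a := by simp only [Finset.mem_sdiff, Finset.mem_erase] at hv; tauto
    rwa [← this]
  rw [incidence, if_pos h1, h2]

theorem exists_eq_erase {x y : K.Simplex} (h : incidence x y ≠ 0) :
    ∃ a ∈ x.1, y.1 = x.1.erase a := by
  have h' : y.1 ⊆ x.1 ∧ x.1.card = y.1.card + 1 := by
    by_contra hc
    exact h (by rw [incidence, if_neg hc])
  obtain ⟨a, ha⟩ := Finset.card_eq_one.1
    (show (x.1 \ y.1).card = 1 by rw [Finset.card_sdiff_of_subset h'.1, h'.2]; omega)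
  have hax : a ∈ x.1 := (Finset.mem_sdiff.1 (ha ▸ Finset.mem_singleton_self a)).1
  refine ⟨a, hax, ?_⟩
  rw [Finset.erase_eq, ← ha, Finset.sdiff_sdiff_eq_self h'.1]

/-- The incidence numbers satisfy `∂ ∂ = 0`. -/
theorem sum_incidence_mul_incidence (x z : K.Simplex) (F : Finset K.Simplex)
    (hF : ∀ y, incidence x y ≠ 0 → y ∈ F) : ∑ y ∈ F, incidence x y * incidence y z = 0 := by
  classical
  -- A nonzero term needs z to arise from x by removing two vertices a < b. Then exactly the two
  -- intermediate faces x ∖ a and x ∖ b contribute.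
  by_cases h : ∃ a ∈ x.1, ∃ b ∈ x.1, a < b ∧ z.1 = (x.1.erase a).erase b
  · obtain ⟨a, ha, b, hb, hab, hz⟩ := h
    have hba : b ∈ x.1.erase a := Finset.mem_erase.2 ⟨hab.ne', hb⟩
    have haa : a ∈ x.1.erase b := Finset.mem_erase.2 ⟨hab.ne, ha⟩
    let y₁ : K.Simplex := ⟨x.1.erase a,
      (K.cplx.isRelLowerSet_faces x.2).2 (Finset.erase_subset _ _) ⟨b, hba⟩⟩
    let y₂ : K.Simplex := ⟨x.1.erase b,
      (K.cplx.isRelLowerSet_faces x.2).2 (Finset.erase_subset _ _) ⟨a, haa⟩⟩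
    have hne : y₁ ≠ y₂ := fun he => by
      have : x.1.erase a = x.1.erase b := congrArg Subtype.val he
      exact Finset.notMem_erase a x.1 (this ▸ haa)
    have e₁ := incidence_of_eq_erase (y := y₁) ha rfl
    have e₂ := incidence_of_eq_erase (y := y₂) hb rfl
    have f₁ := incidence_of_eq_erase (x := y₁) (y := z) hba hz
    have f₂ := incidence_of_eq_erase (x := y₂) (y := z) haa (by rw [hz, Finset.erase_right_comm])
    have hsub : ({y₁, y₂} : Finset K.Simplex) ⊆ F := by
      intro y hy
      refine hF y ?_
      rcases Finset.mem_insert.1 hy with rfl | hy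
      · rw [e₁]; simp
      · rw [Finset.mem_singleton.1 hy, e₂]; simp
    rw [← Finset.sum_subset hsub, Finset.sum_pair hne, e₁, e₂, f₁, f₂]
    · have c₁ : ((x.1.erase a).filter (· < b)).card + 1 = (x.1.filter (· < b)).card := by
        rw [Finset.filter_erase, Finset.card_erase_add_one (Finset.mem_filter.2 ⟨ha, hab⟩)]
      have c₂ : ((x.1.erase b).filter (· < a)).card = (x.1.filter (· < a)).card := by
        rw [Finset.filter_erase, Finset.erase_eq_of_notMem]
        simp [hab.le]
      have s₁ : (K.orient y₁ : ℤ) * (K.orient y₁ : ℤ) = 1 := by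
        rw [← Units.val_mul, Int.units_mul_self, Units.val_one]
      have s₂ : (K.orient y₂ : ℤ) * (K.orient y₂ : ℤ) = 1 := by
        rw [← Units.val_mul, Int.units_mul_self, Units.val_one]
      rw [← c₁]
      change _ * _ * _ * (_ * _ * (-1) ^ ((x.1.erase a).filter (· < b)).card)
        + _ * _ * _ * (_ * _ * (-1) ^ ((x.1.erase b).filter (· < a)).card) = 0
      rw [c₂, pow_succ]
      linear_combination ((K.orient x : ℤ) * (K.orient z : ℤ) * (-1) ^ (x.1.filter (· < a)).card
        * (-1) ^ ((x.1.erase a).filter (· < b)).card) * (s₁ - s₂)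
    · intro y _ hy
      by_contra h0
      obtain ⟨c, hc, hyc⟩ := exists_eq_erase (left_ne_zero_of_mul h0)
      obtain ⟨d, hd, hzd⟩ := exists_eq_erase (right_ne_zero_of_mul h0)
      have hcz : c ∉ z.1 := by rw [hzd, hyc]; simp
      -- The vertex removed in passing from x to y is missing from z as well, so it is one of the
      -- two.
      have hcab : c = a ∨ c = b := by
        rw [hz] at hcz
        by_contra! hn
        exact hcz (Finset.mem_erase.2 ⟨hn.2, Finset.mem_erase.2 ⟨hn.1, hc⟩⟩)
      rcases hcab with rfl | rfl
      · exact hy (Finset.mem_insert.2 (Or.inl (Subtype.ext hyc)))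
      · exact hy (Finset.mem_insert.2 (Or.inr (Finset.mem_singleton.2 (Subtype.ext hyc))))
  · refine Finset.sum_eq_zero fun y _ => ?_
    by_contra h0
    obtain ⟨c, hc, hyc⟩ := exists_eq_erase (left_ne_zero_of_mul h0)
    obtain ⟨d, hd, hzd⟩ := exists_eq_erase (right_ne_zero_of_mul h0)
    rw [hyc] at hd hzd
    have hdc := Finset.mem_erase.1 hd
    rcases hdc.1.lt_or_gt with hlt | hlt
    · exact h ⟨d, hdc.2, c, hc, hlt, by rw [hzd, Finset.erase_right_comm]⟩
    · exact h ⟨c, hc, d, hdc.2, hlt, hzd⟩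

/-- As in any total complex, the purely geometric term vanishes by ∂∂ = 0 and the purely algebraic
one by `G.bdry_bdry`. The two mixed terms agree up to the sign (-1)^p, which changes from p to p +
1, so they cancel. -/
theorem coboundaryTotal_coboundaryTotal (p : ℤ) (t : K.Simplex →₀ ∀ j, G.grp j) :
    coboundaryTotal K G (p + 1) (coboundaryTotal K G p t) = 0 := by
  classical
  induction t using Finsupp.induction_linear with
  | zero => simp
  | add s t hs ht => rw [map_add, map_add, hs, ht, add_zero]
  | single z g =>
  have h1 : ∀ y j, coboundaryTotal K G p (Finsupp.single z g) y j
      = incidence y z • g j - p.negOnePow • G.bdry (j + 1) j (Finsupp.single z g y (j + 1)) :=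
    fun y j => by rw [coboundaryTotal_apply, Finsupp.sum_single_index (by simp)]
  ext x j
  rw [coboundaryTotal_apply, h1]
  -- One index set serves all sums: it contains the support of the inner coboundary, every face of x
  -- (needed for ∂∂ = 0), and z, the only simplex at which the algebraic term can be nonzero.
  let F : Finset K.Simplex := insert z
    ((coboundaryTotal K G p (Finsupp.single z g)).support ∪ (finite_faces x).toFinset)
  have hsum : ((coboundaryTotal K G p (Finsupp.single z g)).sum fun y g => incidence x y • g j)
      = ∑ y ∈ F, incidence x y • coboundaryTotal K G p (Finsupp.single z g) y j :=
    Finset.sum_subset (Finset.subset_union_left.trans (Finset.subset_insert _ _))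
      fun y _ hy => by rw [Finsupp.notMem_support_iff.1 hy]; simp
  have h2 : ∑ y ∈ F, incidence x y • incidence y z • g j = 0 := by
    simp only [smul_smul]
    rw [← Finset.sum_smul, sum_incidence_mul_incidence x z F (fun y hy => Finset.mem_insert_of_mem
      (Finset.mem_union_right _ ((finite_faces x).mem_toFinset.2 hy))), zero_smul]
  have h3 : ∑ y ∈ F, incidence x y • p.negOnePow • G.bdry (j + 1) j
      (Finsupp.single z g y (j + 1)) = incidence x z • p.negOnePow • G.bdry (j + 1) j
        (g (j + 1)) := by
    rw [Finset.sum_eq_single_of_mem z (Finset.mem_insert_self _ _), Finsupp.single_eq_same]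
    intro y _ hy
    rw [Finsupp.single_eq_of_ne hy]
    simp
  rw [hsum]
  simp only [h1, smul_sub, Finset.sum_sub_distrib]
  have h4 : G.bdry (j + 1) j (p.negOnePow • G.bdry (j + 1 + 1) (j + 1)
      (Finsupp.single z g x (j + 1 + 1))) = 0 := by
    rw [Units.smul_def, map_zsmul, G.bdry_bdry, smul_zero]
  rw [h2, h3, map_sub, map_zsmul, h4, sub_zero, Int.negOnePow_succ, Units.neg_smul, zero_sub,
    sub_neg_eq_add, Units.smul_def, Units.smul_def, smul_comm (incidence x z), neg_add_cancel]
  rfl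

theorem coboundaries_le_cocycles : coboundaries K G ≤ cocycles K G := by
  rintro _ ⟨s, rfl⟩
  exact Subtype.ext (coboundaryTotal_coboundaryTotal (-1) s.1)

/-- Duality replaces a second sign computation: a boundary that is not a cycle would pair
nontrivially with some coboundary, but boundaries pair trivially with cocycles, and coboundaries are
cocycles. -/
theorem boundaries_le_cycles : boundaries K G ≤ cycles K G := by
  rintro _ ⟨ν, rfl⟩
  by_contra h
  obtain ⟨s, -, -, h1, -⟩ := exists_detect_cycle _ h
  exact h1 (pairing_boundary_of_mem ν _ (coboundaries_le_cocycles ⟨s, rfl⟩))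

end BoundarySquared

/-! ### Descent to the logical algebra and extension back to 𝔄 -/

section Correspondence

theorem isClosed_fixingAlgebra : IsClosed (fixingAlgebra K G : Set (QuasiLocal K G)) :=
  Set.isClosed_centralizer _

/-- The restriction of a continuous functional to the fixing algebra. -/
def restrictFixing (ω : WeakDual ℂ (QuasiLocal K G)) : fixingAlgebra K G →L[ℂ] ℂ :=
  (ω : QuasiLocal K G →L[ℂ] ℂ).comp
    ⟨(fixingAlgebra K G).subtype.toLinearMap, continuous_subtype_val⟩

/-- A redundancy compares P_{t'} Q_{γ'} with A_s P_{t'} Q_{γ'} B_ν, and the state absorbs A_s on the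
left and B_ν on the right. Continuity passes to the closed span. -/
theorem restrictFixing_eq_zero {ω : WeakDual ℂ (QuasiLocal K G)} (hω : ω ∈ ffGroundStates K G)
    {d : fixingAlgebra K G} (hd : d ∈ redundancySpace K G) : restrictFixing ω d = 0 := by
  obtain ⟨hs, hA, hB⟩ := mem_ffGroundStates_iff.1 hω
  have hle : redundancySpace K G ≤ LinearMap.ker (restrictFixing ω).toLinearMap := by
    refine Submodule.topologicalClosure_minimal _ (Submodule.span_le.2 ?_)
      (restrictFixing ω).isClosed_ker
    rintro d ⟨t, -, t', -, γ, -, γ', -, ⟨s, hst⟩, ⟨ν, hν⟩, hd⟩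
    have ht : P K G t = A K G s * P K G t' := by
      rw [A, P_mul, hst, sub_add_cancel]
    have hγ : Q K G γ = Q K G γ' * B K G ν := by
      rw [B, Q_mul, hν, add_sub_cancel]
    change ω d.1 = 0
    rw [hd, map_sub, ht, hγ, sub_eq_zero, mul_assoc, ← mul_assoc (P K G t')]
    exact (apply_unitary_mul (ω : QuasiLocal K G →L[ℂ] ℂ).toLinearMap hs.1 hs.2
      (A_mul_star_A s) (by exact congrArg Complex.re (hA s)) _).trans
      (apply_mul_unitary (ω : QuasiLocal K G →L[ℂ] ℂ).toLinearMap hs.1 hs.2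
      (star_B_mul_B ν) (by exact congrArg Complex.re (hB ν)) _)
  exact hle hd

/-- A continuous functional on the fixing algebra that vanishes on the redundancy space, as a
functional on the logical algebra. -/
def descend (f : fixingAlgebra K G →L[ℂ] ℂ) (hf : ∀ d ∈ redundancySpace K G, f d = 0) :
    WeakDual ℂ (LogicalAlgebra K G) :=
  StrongDual.toWeakDual
  { toFun := Quotient.lift f fun a b h => by
      have h := (Submodule.quotientRel_def _).1 h
      have := hf _ h
      rwa [map_sub, sub_eq_zero] at this
    map_add' := by
      rintro ⟨a⟩ ⟨b⟩
      exact map_add f a b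
    map_smul' := by
      rintro c ⟨a⟩
      exact map_smul f c a
    cont := f.continuous.quotient_lift _ }

theorem descend_logicalClass (f : fixingAlgebra K G →L[ℂ] ℂ)
    (hf : ∀ d ∈ redundancySpace K G, f d = 0) (X : fixingAlgebra K G) :
    descend f hf (logicalClass K G X) = f X := rfl

theorem logicalClass_surjective : Function.Surjective (logicalClass K G) :=
  Ideal.Quotient.mk_surjective

theorem logicalClass_smul (c : ℂ) (X : fixingAlgebra K G) :
    logicalClass K G (c • X) = c • logicalClass K G X := rfl

theorem star_logicalClass (X : fixingAlgebra K G) :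
    star (logicalClass K G X) = logicalClass K G (star X) := rfl

/-- Every class has a representative in the fixing algebra, so positivity and normalization are read
off from ω; no norm on the quotient is involved. -/
theorem descend_mem_stateSpace {ω : WeakDual ℂ (QuasiLocal K G)} (hω : ω ∈ ffGroundStates K G) :
    descend (restrictFixing ω) (fun _ => restrictFixing_eq_zero hω)
      ∈ stateSpace (LogicalAlgebra K G) := by
  refine ⟨fun a => ?_, ?_⟩
  · obtain ⟨X, rfl⟩ := logicalClass_surjective a
    rw [star_logicalClass, ← map_mul, descend_logicalClass]
    exact hω.1.1.1 X.1
  · rw [← map_one (logicalClass K G), descend_logicalClass]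
    exact hω.1.1.2

/-- Such a monomial m commutes with some A or B only up to a scalar c ≠ 1. Absorbing that unitary on
either side gives ω(m) = c ω(m). -/
theorem apply_monomial_eq_zero {ω : WeakDual ℂ (QuasiLocal K G)} (hω : ω ∈ ffGroundStates K G)
    {i : Hom₀ K G 0 × HomDual₀ K G 0} (hi : ¬ (i.1 ∈ cocycles K G ∧ i.2 ∈ cycles K G)) :
    ω (monomial i) = 0 := by
  obtain ⟨hs, hA, hB⟩ := mem_ffGroundStates_iff.1 hω
  -- The disjunction covers both placements of the scalar, since `A_mul_monomial` and
  -- `B_mul_monomial` put it on opposite orders of the product.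
  have key : ∀ (u : QuasiLocal K G) (c : ℂ), ω (u * monomial i) = ω (monomial i) →
      ω (monomial i * u) = ω (monomial i) → c ≠ 1 →
      (u * monomial i = c • (monomial i * u) ∨ monomial i * u = c • (u * monomial i)) →
      ω (monomial i) = 0 := fun u c h1 h2 hc h => by
    have : ω (monomial i) = c * ω (monomial i) := by
      rcases h with h | h
      · conv_lhs => rw [← h1, h, map_smul, h2, smul_eq_mul]
      · conv_lhs => rw [← h2, h, map_smul, h1, smul_eq_mul]
    by_contra h0
    exact hc (mul_right_cancel₀ h0 (by rw [← this, one_mul]))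
  by_cases hγ : i.2 ∈ cycles K G
  · obtain ⟨ν, -, -, h1, -⟩ := exists_detect_cocycle i.1 fun h => hi ⟨h, hγ⟩
    exact key (B K G ν) _
      (apply_unitary_mul (ω : QuasiLocal K G →L[ℂ] ℂ).toLinearMap hs.1 hs.2
        (B_mul_star_B ν) (by exact congrArg Complex.re (hB ν)) _)
      (apply_mul_unitary (ω : QuasiLocal K G →L[ℂ] ℂ).toLinearMap hs.1 hs.2
        (star_B_mul_B ν) (by exact congrArg Complex.re (hB ν)) _) h1
      (Or.inl (B_mul_monomial ν i))
  · obtain ⟨s, -, -, h1, -⟩ := exists_detect_cycle i.2 hγ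
    exact key (A K G s) _
      (apply_unitary_mul (ω : QuasiLocal K G →L[ℂ] ℂ).toLinearMap hs.1 hs.2
        (A_mul_star_A s) (by exact congrArg Complex.re (hA s)) _)
      (apply_mul_unitary (ω : QuasiLocal K G →L[ℂ] ℂ).toLinearMap hs.1 hs.2
        (star_A_mul_A s) (by exact congrArg Complex.re (hA s)) _) h1
      (Or.inr (A_mul_monomial s i))

/-- A frustration-free ground state is determined by its restriction to the fixing algebra. -/
theorem eq_of_eq_on_fixingAlgebra {ω₁ ω₂ : WeakDual ℂ (QuasiLocal K G)}
    (h₁ : ω₁ ∈ ffGroundStates K G) (h₂ : ω₂ ∈ ffGroundStates K G)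
    (h : ∀ X : fixingAlgebra K G, ω₁ (X : QuasiLocal K G) = ω₂ (X : QuasiLocal K G)) :
    ω₁ = ω₂ := by
  let f : QuasiLocal K G →L[ℂ] ℂ := (ω₁ : QuasiLocal K G →L[ℂ] ℂ) - (ω₂ : QuasiLocal K G →L[ℂ] ℂ)
  -- The difference vanishes on monomials of the fixing algebra by assumption, and on all others
  -- because both states kill them; the span of the monomials is dense.
  have hspan : Submodule.span ℂ (Set.range (monomial (K := K) (G := G)))
      ≤ LinearMap.ker f.toLinearMap := by
    refine Submodule.span_le.2 ?_
    rintro _ ⟨i, rfl⟩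
    change ω₁ (monomial i) - ω₂ (monomial i) = 0
    by_cases hi : i.1 ∈ cocycles K G ∧ i.2 ∈ cycles K G
    · exact sub_eq_zero.2 (h ⟨_, monomial_mem_fixingAlgebra i hi.1 hi.2⟩)
    · rw [apply_monomial_eq_zero h₁ hi, apply_monomial_eq_zero h₂ hi, sub_zero]
  refine DFunLike.ext _ _ fun T => ?_
  have hT : T ∈ closure (LinearMap.ker f.toLinearMap : Set (QuasiLocal K G)) :=
    Metric.mem_closure_iff.2 fun ε hε => by
      obtain ⟨R, hR, hd⟩ := exists_approx T hε
      exact ⟨R, hspan hR, by rwa [dist_eq_norm]⟩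
  rw [f.isClosed_ker.closure_eq] at hT
  exact sub_eq_zero.1 hT

/-- The pair is compared with the trivial pair (0, 0). A redundancy requires cocycles and cycles,
and this is where ∂∂ = 0 enters. -/
theorem sub_one_mem_redundancySpace {i : Hom₀ K G 0 × HomDual₀ K G 0} {X : fixingAlgebra K G}
    (ht : i.1 ∈ coboundaries K G) (hγ : i.2 ∈ boundaries K G)
    (hX : (X : QuasiLocal K G) = monomial i) :
    X - 1 ∈ redundancySpace K G := by
  refine Submodule.le_topologicalClosure _ (Submodule.subset_span
    ⟨i.1, coboundaries_le_cocycles ht, 0, zero_mem _, i.2, boundaries_le_cycles hγ, 0, zero_mem _,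
      by rwa [sub_zero], by rwa [sub_zero], ?_⟩)
  rw [P_zero, Q_zero, one_mul]
  change (X : QuasiLocal K G) - 1 = _
  rw [hX]
  rfl

/-- Every state of the logical algebra is induced by a frustration-free ground state. -/
theorem exists_ffGroundState {ρ : WeakDual ℂ (LogicalAlgebra K G)}
    (hρ : ρ ∈ stateSpace (LogicalAlgebra K G)) :
    ∃ ω ∈ ffGroundStates K G, ∀ X : fixingAlgebra K G,
      ω (X : QuasiLocal K G) = ρ (logicalClass K G X) := by
  let f : fixingAlgebra K G →ₗ[ℂ] ℂ :=
    { toFun := fun X => ρ (logicalClass K G X)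
      map_add' := fun X Y => by rw [map_add, map_add]
      map_smul' := fun c X => by rw [logicalClass_smul, map_smul]; rfl }
  obtain ⟨ω, hω, h⟩ := exists_extension_state (fixingAlgebra K G) isClosed_fixingAlgebra f
    (fun a => by
      change 0 ≤ ρ (logicalClass K G (star a * a))
      rw [map_mul, ← star_logicalClass]
      exact hρ.1 _)
    (by
      change ρ (logicalClass K G 1) = 1
      rw [map_one]
      exact hρ.2)
  -- The Hahn–Banach extension is arbitrary outside the fixing algebra. These monomials lie inside
  -- it and have logical class 1, so every choice of extension is frustration-free.
  have key : ∀ i : Hom₀ K G 0 × HomDual₀ K G 0, i.1 ∈ coboundaries K G → i.2 ∈ boundaries K G →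
      ω (monomial i) = 1 := fun i ht hγ => by
    let X : fixingAlgebra K G := ⟨monomial i, monomial_mem_fixingAlgebra i
      (coboundaries_le_cocycles ht) (boundaries_le_cycles hγ)⟩
    have hX : logicalClass K G X = logicalClass K G 1 :=
      Ideal.Quotient.eq.2 (sub_one_mem_redundancySpace ht hγ rfl)
    refine (h X).trans ?_
    change ρ (logicalClass K G X) = 1
    rw [hX, map_one]
    exact hρ.2
  refine ⟨ω, mem_ffGroundStates_iff.2 ⟨hω, fun s => ?_, fun ν => ?_⟩, h⟩
  · have := key (_, 0) ⟨s, rfl⟩ (zero_mem _)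
    rwa [monomial, Q_zero, mul_one] at this
  · have := key (0, _) (zero_mem _) ⟨ν, rfl⟩
    rwa [monomial, P_zero, one_mul] at this

/-- The state of the logical algebra induced by a frustration-free ground state. -/
def logicalState (ω : ffGroundStates K G) : stateSpace (LogicalAlgebra K G) :=
  ⟨_, descend_mem_stateSpace ω.2⟩

theorem logicalState_apply (ω : ffGroundStates K G) (X : fixingAlgebra K G) :
    (logicalState ω : WeakDual ℂ (LogicalAlgebra K G)) (logicalClass K G X)
      = (ω : WeakDual ℂ (QuasiLocal K G)) (X : QuasiLocal K G) := rfl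

theorem eq_logicalState_iff (ω : ffGroundStates K G) (ρ : stateSpace (LogicalAlgebra K G)) :
    logicalState ω = ρ ↔ ∀ X : fixingAlgebra K G,
      (ω : WeakDual ℂ (QuasiLocal K G)) (X : QuasiLocal K G)
        = (ρ : WeakDual ℂ (LogicalAlgebra K G)) (logicalClass K G X) := by
  refine ⟨fun h X => by rw [← h, logicalState_apply], fun h => Subtype.ext ?_⟩
  refine DFunLike.ext _ _ fun a => ?_
  obtain ⟨X, rfl⟩ := logicalClass_surjective a
  rw [logicalState_apply, h]

theorem logicalState_bijective : Function.Bijective (logicalState (K := K) (G := G)) := by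
  refine ⟨fun ω ω' h => Subtype.ext (eq_of_eq_on_fixingAlgebra ω.2 ω'.2 fun X => ?_), fun ρ => ?_⟩
  · rw [← logicalState_apply, h, logicalState_apply]
  · obtain ⟨ω, hω, h⟩ := exists_ffGroundState ρ.2
    exact ⟨⟨ω, hω⟩, (eq_logicalState_iff _ _).2 h⟩

/-- Evaluation at the class of X pulls back to evaluation at X, which is weak-* continuous. -/
theorem continuous_logicalState : Continuous (logicalState (K := K) (G := G)) := by
  refine Continuous.subtype_mk (WeakDual.continuous_of_continuous_eval fun a => ?_) _
  obtain ⟨X, rfl⟩ := logicalClass_surjective a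
  exact (WeakDual.eval_continuous (X : QuasiLocal K G)).comp continuous_subtype_val

variable (K G) in
/-- The homeomorphism between frustration-free ground states and states of the logical algebra. -/
def logicalStateHomeomorph : ffGroundStates K G ≃ₜ stateSpace (LogicalAlgebra K G) :=
  haveI : CompactSpace (ffGroundStates K G) := isCompact_iff_compactSpace.1 isCompact_ffGroundStates
  Continuous.homeoOfEquivCompactToT2 (f := Equiv.ofBijective _ logicalState_bijective)
    continuous_logicalState

/-! ### Convexity and pure states -/

/-- Restriction and descent are linear, so `logicalState` is affine; this lets it match extreme
points. -/
theorem coe_logicalState_convex {ω ω₁ ω₂ : ffGroundStates K G} {a b : ℝ}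
    (h : a • (ω₁ : WeakDual ℂ (QuasiLocal K G)) + b • (ω₂ : WeakDual ℂ (QuasiLocal K G)) = ω) :
    a • (logicalState ω₁ : WeakDual ℂ (LogicalAlgebra K G))
      + b • (logicalState ω₂ : WeakDual ℂ (LogicalAlgebra K G)) = logicalState ω := by
  refine DFunLike.ext _ _ fun x => ?_
  obtain ⟨X, rfl⟩ := logicalClass_surjective x
  exact DFunLike.congr_fun h (X : QuasiLocal K G)

theorem convex_stateSpace (R : Type*) [Ring R] [StarRing R] [Algebra ℂ R] [TopologicalSpace R]
    {ω₁ ω₂ : WeakDual ℂ R} (h₁ : ω₁ ∈ stateSpace R) (h₂ : ω₂ ∈ stateSpace R) {a b : ℝ}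
    (ha : 0 < a) (hb : 0 < b) (hab : a + b = 1) : a • ω₁ + b • ω₂ ∈ stateSpace R := by
  refine ⟨fun x => ?_, ?_⟩
  · change 0 ≤ (a : ℂ) * ω₁ (star x * x) + (b : ℂ) * ω₂ (star x * x)
    exact add_nonneg (mul_nonneg (Complex.zero_le_real.2 ha.le) (h₁.1 x))
      (mul_nonneg (Complex.zero_le_real.2 hb.le) (h₂.1 x))
  · change (a : ℂ) * ω₁ 1 + (b : ℂ) * ω₂ 1 = 1
    rw [h₁.2, h₂.2, mul_one, mul_one, ← Complex.ofReal_add, hab, Complex.ofReal_one]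

theorem convex_ffGroundStates {ω₁ ω₂ : WeakDual ℂ (QuasiLocal K G)}
    (h₁ : ω₁ ∈ ffGroundStates K G) (h₂ : ω₂ ∈ ffGroundStates K G) {a b : ℝ}
    (ha : 0 < a) (hb : 0 < b) (hab : a + b = 1) : a • ω₁ + b • ω₂ ∈ ffGroundStates K G := by
  rw [mem_ffGroundStates_iff] at h₁ h₂ ⊢
  refine ⟨convex_stateSpace _ h₁.1 h₂.1 ha hb hab, fun s => ?_, fun ν => ?_⟩
  · change (a : ℂ) * ω₁ _ + (b : ℂ) * ω₂ _ = 1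
    rw [h₁.2.1, h₂.2.1, mul_one, mul_one, ← Complex.ofReal_add, hab, Complex.ofReal_one]
  · change (a : ℂ) * ω₁ _ + (b : ℂ) * ω₂ _ = 1
    rw [h₁.2.2, h₂.2.2, mul_one, mul_one, ← Complex.ofReal_add, hab, Complex.ofReal_one]

/-- A frustration-free ground state is pure iff the induced state of the logical algebra is. -/
theorem logicalState_mem_pureStates_iff (ω : ffGroundStates K G) :
    (logicalState ω : WeakDual ℂ (LogicalAlgebra K G)) ∈ pureStates (LogicalAlgebra K G) ↔
      (ω : WeakDual ℂ (QuasiLocal K G)) ∈ pureFFGroundStates K G := by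
  constructor
  · intro h
    refine ⟨ω.2, ω.2.1.1, fun ω₁ h₁ ω₂ h₂ hseg => ?_⟩
    obtain ⟨a, b, ha, hb, hab, he⟩ := hseg
    -- Purity is tested against all states of 𝔄. The face property makes the components
    -- frustration-free, so that `logicalState` applies to them.
    obtain ⟨k₁, k₂⟩ := mem_ffGroundStates_of_convex h₁ h₂ ha hb hab (he ▸ ω.2)
    have hc := coe_logicalState_convex (ω₁ := ⟨ω₁, k₁⟩) (ω₂ := ⟨ω₂, k₂⟩) he
    have := h.2 (logicalState ⟨ω₁, k₁⟩).2 (logicalState ⟨ω₂, k₂⟩).2 ⟨a, b, ha, hb, hab, hc⟩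
    exact congrArg Subtype.val (logicalState_bijective.1 (Subtype.ext this))
  · rintro ⟨-, h⟩
    refine ⟨(logicalState ω).2, fun ρ₁ h₁ ρ₂ h₂ hseg => ?_⟩
    obtain ⟨a, b, ha, hb, hab, he⟩ := hseg
    obtain ⟨ω₁, e₁⟩ := logicalState_bijective.2 ⟨ρ₁, h₁⟩
    obtain ⟨ω₂, e₂⟩ := logicalState_bijective.2 ⟨ρ₂, h₂⟩
    -- The same combination of the lifted components is frustration-free and induces the given
    -- logical state, hence equals ω by injectivity.
    have hc := coe_logicalState_convex (ω₁ := ω₁) (ω₂ := ω₂)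
      (ω := ⟨_, convex_ffGroundStates ω₁.2 ω₂.2 ha hb hab⟩) rfl
    rw [e₁, e₂] at hc
    have hω := logicalState_bijective.1 (Subtype.ext (hc.symm.trans he))
    have := h.2 ω₁.2.1.1 ω₂.2.1.1 ⟨a, b, ha, hb, hab, congrArg Subtype.val hω⟩
    have := e₁.symm.trans (congrArg logicalState (Subtype.ext this))
    exact congrArg Subtype.val this

end Correspondence

end

end HAQDM

/-! ### The homeomorphism Φ and its restriction to pure states -/

theorem mainTheorem5 {V : Type*} [LinearOrder V] {N L : ℕ}
    (K : HAQDM.GeometricData V N L) (G : HAQDM.AlgebraicData N) :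
    -- the homeomorphism `Φ` and its restriction to the pure states
    (∃ Φ : ↥(HAQDM.stateSpace (HAQDM.LogicalAlgebra K G)) ≃ₜ ↥(HAQDM.ffGroundStates K G),
      (∀ (ρ : ↥(HAQDM.stateSpace (HAQDM.LogicalAlgebra K G))) (ω : ↥(HAQDM.ffGroundStates K G)),
        Φ ρ = ω ↔ ∀ R : HAQDM.fixingAlgebra K G,
          (ω : WeakDual ℂ (HAQDM.QuasiLocal K G)) (R : HAQDM.QuasiLocal K G)
            = (ρ : WeakDual ℂ (HAQDM.LogicalAlgebra K G)) (HAQDM.logicalClass K G R)) ∧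
      (∀ ρ : ↥(HAQDM.stateSpace (HAQDM.LogicalAlgebra K G)),
        (ρ : WeakDual ℂ (HAQDM.LogicalAlgebra K G)) ∈ HAQDM.pureStates (HAQDM.LogicalAlgebra K G) ↔
          (Φ ρ : WeakDual ℂ (HAQDM.QuasiLocal K G)) ∈ HAQDM.pureFFGroundStates K G) ∧
      ∃ Ψ : ↥(HAQDM.pureStates (HAQDM.LogicalAlgebra K G)) ≃ₜ ↥(HAQDM.pureFFGroundStates K G),
        ∀ (ρ : WeakDual ℂ (HAQDM.LogicalAlgebra K G))
          (hρ : ρ ∈ HAQDM.pureStates (HAQDM.LogicalAlgebra K G)),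
          (Ψ ⟨ρ, hρ⟩ : WeakDual ℂ (HAQDM.QuasiLocal K G)) = Φ ⟨ρ, hρ.1⟩) ∧
    -- convex components of frustration-free ground states are frustration-free ground states
    (∀ ω ∈ HAQDM.ffGroundStates K G,
      ∀ ω₁ ∈ HAQDM.stateSpace (HAQDM.QuasiLocal K G),
      ∀ ω₂ ∈ HAQDM.stateSpace (HAQDM.QuasiLocal K G),
      ∀ c : ℝ, 0 < c → c < 1 → ω = c • ω₁ + (1 - c) • ω₂ →
        ω₁ ∈ HAQDM.ffGroundStates K G ∧ ω₂ ∈ HAQDM.ffGroundStates K G) := by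
  -- Φ is the inverse of the restriction map, so its defining property is `eq_logicalState_iff` read
  -- backwards.
  let Φ := (HAQDM.logicalStateHomeomorph K G).symm
  have hΦ : ∀ ρ, HAQDM.logicalState (Φ ρ) = ρ := (HAQDM.logicalStateHomeomorph K G).apply_symm_apply
  have hpure : ∀ ρ : ↥(HAQDM.stateSpace (HAQDM.LogicalAlgebra K G)),
      (ρ : WeakDual ℂ (HAQDM.LogicalAlgebra K G)) ∈ HAQDM.pureStates (HAQDM.LogicalAlgebra K G) ↔
        (Φ ρ : WeakDual ℂ (HAQDM.QuasiLocal K G)) ∈ HAQDM.pureFFGroundStates K G := fun ρ => by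
    rw [← HAQDM.logicalState_mem_pureStates_iff, hΦ]
  refine ⟨⟨Φ, fun ρ ω => ?_, hpure, ?_⟩, fun ω hω ω₁ h₁ ω₂ h₂ c hc hc' h => ?_⟩
  · rw [← HAQDM.eq_logicalState_iff, Homeomorph.symm_apply_eq, eq_comm]
    rfl
  -- By `hpure`, Φ and its inverse preserve purity, so Ψ is obtained by restricting both maps.
  · exact ⟨{
      toFun := fun ρ => ⟨Φ ⟨ρ.1, ρ.2.1⟩, (hpure ⟨ρ.1, ρ.2.1⟩).1 ρ.2⟩
      invFun := fun ω => ⟨Φ.symm ⟨ω.1, ω.2.1⟩, (hpure _).2 (by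
        rw [Homeomorph.apply_symm_apply]; exact ω.2)⟩
      left_inv := fun ρ => Subtype.ext (by
        have h := congrArg Subtype.val (Φ.symm_apply_apply ⟨ρ.1, ρ.2.1⟩)
        exact h)
      right_inv := fun ω => Subtype.ext (by
        have h := congrArg Subtype.val (Φ.apply_symm_apply ⟨ω.1, ω.2.1⟩)
        exact h)
      continuous_toFun := Continuous.subtype_mk (continuous_subtype_val.comp
        (Φ.continuous.comp (Continuous.subtype_mk continuous_subtype_val _))) _
      continuous_invFun := Continuous.subtype_mk (continuous_subtype_val.comp
        (Φ.symm.continuous.comp (Continuous.subtype_mk continuous_subtype_val _))) _ },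
      fun ρ hρ => rfl⟩
  · exact HAQDM.mem_ffGroundStates_of_convex h₁ h₂ hc (sub_pos.2 hc') (add_sub_cancel c 1) (h ▸ hω)
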